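/- Let $1/2<H<1$, $\alpha>0$, $T\in(0,\infty)$, and let $Y_{\ell m}$ ($\ell\ge 0$, $-\ell\le m\le\ell$) be the standard complex spherical harmonics on the unit sphere $\mathbb S^2\subset\mathbb R^3$, orthonormal for the surface measure $\nu$ and with $\overline{Y_{\ell m}}=(-1)^mY_{\ell,-m}$. **Noise.** On a probability space let $\{\beta_{\ell m}(t),\,t\ge 0\}$ be complex Gaussian processes with $\overline{\beta_{\ell m}(t)}=(-1)^m\beta_{\ell,-m}(t)$ a.s., such that the processes $\beta_{\ell 0}$ ($\ell\ge 0$) and $\sqrt2\,\mathrm{Re}\,\beta_{\ell m}$, $\sqrt2\,\mathrm{Im}\,\beta_{\ell m}$ ($1\le m\le\ell$) are independent real fractional Brownian motions of Hurst index $H$, i.e. centred Gaussian processes with covariance $\frac12\left(t^{2H}+s^{2H}-|t-s|^{2H}\right)$. Let $C_\ell=\Upsilon(\ell)(\ell+\frac12)^{-\alpha}$ with $c_0^{-1}\le\Upsilon(\ell)\le c_0$ for all $\ell\ge 0$ and some $c_0>1$ (Condition (A.1)). The noise is $W^H(t,x)=\sum_{\ell,m}\sqrt{C_\ell}\,\beta_{\ell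 m}(t)Y_{\ell m}(x)$. **Initial value.** Either $u_0\equiv0$, or $u_0\in L^2(\Omega\times\mathbb S^2)$ is a zero-mean isotropic Gaussian random field on $\mathbb S^2$, independent of $W^H$, whose angular power spectrum $D_\ell=\mathbb E|u_{0,\ell m}|^2$, where $u_{0,\ell m}=\int_{\mathbb S^2}u_0\overline{Y_{\ell m}}\,d\nu$, satisfies $D_\ell\le D_0(\ell+\frac12)^{-\beta}$ for all $\ell\ge0$ and some constants $\beta>4$, $D_0>0$ (Condition (A.2)). **Solution.** Let $u=\{u(t,x):t\in[0,T],\,x\in\mathbb S^2\}$ be the mild solution of $du=\Delta_{\mathbb S^2}u\,dt+dW^H$, $u(0)=u_0$, that is, for every $(t,x)$, $$u(t,x)=\sum_{\ell\ge0}\sum_{m=-\ell}^{\ell}\Big(e^{-\ell(\ell+1)t}u_{0,\ell m}+\sqrt{C_\ell}\int_0^te^{-\ell(\ell+1)(t-s)}\,d\beta_{\ell m}(s)\Big)Y_{\ell m}(x),$$ where the series over $\ell$ converges in $L^2(\Omega)$ and the integrals are the $L^2(\Omega)$-limits of the integrals of step functions converging to the integrand in the norm $\|\varphi\|^2=\int_0^T\!\int_0^T\varphi(t)\varphi(s)|t-s|^{2H-2}\,dt\,ds$.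 **Claim.** Put $\eta=H-\max\{(2-\alpha)/4,\,0\}$. Then for every $\delta>0$ there exist constants $K>0$ and $0<\varepsilon<\delta$, not depending on $x$, $t$ or $r$, such that for all $x\in\mathbb S^2$, all $t\in(0,T]$ and all $r\in(0,\varepsilon)$ with $r\le t$, $$\mathrm{Var}\big(u(t,x)\,\big|\,u(s,x):s\in[0,T],\ t-s\ge r\big)\ \ge\ K\,r^{2\eta}\qquad\text{almost surely.}$$ -/

import Mathlib

open MeasureTheory ProbabilityTheory Filter Topology
open scoped NNReal ENNReal ComplexConjugate

noncomputable section

namespace SphereHeat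

/-! ### The unit sphere and the spherical harmonics -/

/-- Euclidean three-space. -/
abbrev E3 : Type := EuclideanSpace ℝ (Fin 3)

/-- The unit sphere `𝕊²` of `ℝ³`. -/
abbrev S2 : Type := Metric.sphere (0 : E3) 1

/-- The surface (Lebesgue) measure `ν` on `𝕊²`, of total mass `4π`. -/
def surfaceMeasure : Measure S2 := (volume : Measure E3).toSphere

/-- The Legendre polynomial `P_ℓ = (2^ℓ ℓ!)⁻¹ dˡ/dzˡ (z² - 1)^ℓ` (Rodrigues), with `P_ℓ(1) = 1`. -/
def legendre (l : ℕ) : Polynomial ℝ :=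
  Polynomial.C ((2 ^ l * (l.factorial : ℝ))⁻¹) *
    (Polynomial.derivative^[l]) ((Polynomial.X ^ 2 - 1) ^ l)

/-- The spherical harmonic `Y_{ℓ m}` for `0 ≤ m ≤ ℓ`, in Cartesian coordinates.
With `x = (sin ϑ cos φ, sin ϑ sin φ, cos ϑ)` one has `(x₀ + i x₁)^m = (sin ϑ)^m e^{imφ}`, so this is
`√((2ℓ+1)/(4π) · (ℓ-m)!/(ℓ+m)!) · P_{ℓ m}(cos ϑ) e^{imφ}` with the associated Legendre function
`P_{ℓ m}(z) = (-1)^m (1-z²)^{m/2} (dᵐ/dzᵐ) P_ℓ(z)`. -/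
def sphHarmNonneg (l m : ℕ) (x : S2) : ℂ :=
  (-1) ^ m *
    ((Real.sqrt ((2 * l + 1) / (4 * Real.pi) *
      (((l - m).factorial : ℝ) / ((l + m).factorial : ℝ))) : ℝ) : ℂ) *
    (((x : E3) 0 : ℂ) + Complex.I * ((x : E3) 1 : ℂ)) ^ m *
    ((((Polynomial.derivative^[m]) (legendre l)).eval ((x : E3) 2) : ℝ) : ℂ)

/-- The spherical harmonic `Y_{ℓ m}` for `|m| ≤ ℓ`: for `m < 0` it is
`Y_{ℓ m} = (-1)^m conj Y_{ℓ, -m}`. -/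
def sphHarm (l : ℕ) (m : ℤ) (x : S2) : ℂ :=
  if 0 ≤ m then sphHarmNonneg l m.natAbs x
  else (-1) ^ m.natAbs * conj (sphHarmNonneg l m.natAbs x)

/-- The index set `{(ℓ, m) : ℓ ≥ 0, -ℓ ≤ m ≤ ℓ}`. -/
abbrev HarmIdx : Type := {p : ℕ × ℤ // |p.2| ≤ (p.1 : ℤ)}

/-! ### Fractional Brownian motion and the noise -/

/-- The covariance function `R_H(t,s) = (t^{2H} + s^{2H} - |t-s|^{2H})/2`. -/
def fbmCov (H : ℝ) (t s : ℝ≥0) : ℝ :=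
  ((t : ℝ) ^ (2 * H) + (s : ℝ) ^ (2 * H) - |(t : ℝ) - (s : ℝ)| ^ (2 * H)) / 2

variable {Ω : Type*} [MeasurableSpace Ω]

/-- A real fractional Brownian motion of Hurst index `H`, indexed by `ℝ₊`: a centred Gaussian
process with covariance function `R_H`. -/
structure IsFBM (P : Measure Ω) (H : ℝ) (B : ℝ≥0 → Ω → ℝ) : Prop where
  gaussian : IsGaussianProcess B P
  centered : ∀ t, ∫ ω, B t ω ∂P = 0
  covariance : ∀ t s, ∫ ω, B t ω * B s ω ∂P = fbmCov H t s

/-- The real processes that carry the complex family `β_{ℓ m}`: `β_{ℓ 0}` (at `m = 0`, where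
`β_{ℓ 0}` is real), `√2 Re β_{ℓ m}` (at `m > 0`) and `√2 Im β_{ℓ, |m|}` (at `m < 0`). -/
def realComponent (β : ℕ → ℤ → ℝ≥0 → Ω → ℂ) (l : ℕ) (m : ℤ) (t : ℝ≥0) (ω : Ω) : ℝ :=
  if m = 0 then (β l 0 t ω).re
  else if 0 < m then Real.sqrt 2 * (β l m t ω).re
  else Real.sqrt 2 * (β l (-m) t ω).im

/-- The family `β_{ℓ m}`, `|m| ≤ ℓ`, of complex Gaussian processes that are the coefficients of the
noise `W^H(t,x) = ∑_{ℓ m} √C_ℓ β_{ℓ m}(t) Y_{ℓ m}(x)`. -/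
structure IsNoiseFamily (P : Measure Ω) (H : ℝ) (β : ℕ → ℤ → ℝ≥0 → Ω → ℂ) : Prop where
  measurable : ∀ (l : ℕ) (m : ℤ), |m| ≤ (l : ℤ) → ∀ t, Measurable (β l m t)
  conj_eq : ∀ (l : ℕ) (m : ℤ), |m| ≤ (l : ℤ) → ∀ t, ∀ᵐ ω ∂P,
    conj (β l m t ω) = (-1) ^ m.natAbs * β l (-m) t ω
  fbm : ∀ (l : ℕ) (m : ℤ), |m| ≤ (l : ℤ) → IsFBM P H (realComponent β l m)
  indep : iIndepFun
    (fun (p : HarmIdx) (ω : Ω) (t : ℝ≥0) => realComponent β p.1.1 p.1.2 t ω) P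

/-- The growth condition on the noise coefficients: `α > 0` and, for some `c₀ > 1`,
`C_ℓ = Υ(ℓ) (ℓ + 1/2)^{-α}` with `c₀⁻¹ ≤ Υ(ℓ) ≤ c₀` for all `ℓ ≥ 0`. -/
def HasPowerDecay (C : ℕ → ℝ) (α : ℝ) : Prop :=
  0 < α ∧ ∃ c₀ : ℝ, 1 < c₀ ∧ ∃ Υ : ℕ → ℝ, ∀ l : ℕ,
    C l = Υ l * ((l : ℝ) + 1 / 2) ^ (-α) ∧ c₀⁻¹ ≤ Υ l ∧ Υ l ≤ c₀

/-! ### The stochastic integral with respect to fractional Brownian motion -/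

/-- A linear combination of indicators `1_{[a,b]}` with `0 ≤ a < b ≤ T`. -/
structure StepFun (T : ℝ≥0) where
  n : ℕ
  coeff : Fin n → ℝ
  left : Fin n → ℝ≥0
  right : Fin n → ℝ≥0
  left_lt_right : ∀ i, left i < right i
  right_le : ∀ i, right i ≤ T

/-- The function `∑ᵢ cᵢ 1_{[aᵢ,bᵢ]}`. -/
def StepFun.eval {T : ℝ≥0} (σ : StepFun T) (s : ℝ) : ℝ :=
  ∑ i, σ.coeff i * (Set.Icc (σ.left i : ℝ) (σ.right i : ℝ)).indicator (fun _ => (1 : ℝ)) s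

/-- The elementary integral `∑ᵢ cᵢ (B(bᵢ) - B(aᵢ))` of a step function. -/
def StepFun.integral {T : ℝ≥0} (σ : StepFun T) (B : ℝ≥0 → Ω → ℂ) (ω : Ω) : ℂ :=
  ∑ i, (σ.coeff i : ℂ) * (B (σ.right i) ω - B (σ.left i) ω)

/-- The kernel `(t,s) ↦ φ(t) φ(s) |t-s|^{2H-2}` of the squared norm of `𝓗([0,T])`. -/
def energyKernel (H : ℝ) (φ : ℝ → ℝ) (p : ℝ × ℝ) : ℝ :=
  φ p.1 * φ p.2 * |p.1 - p.2| ^ (2 * H - 2)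

/-- The squared norm `∫₀ᵀ∫₀ᵀ φ(t) φ(s) |t-s|^{2H-2} dt ds` of `φ` in `𝓗([0,T])`, for `H > 1/2`. -/
def energy (H : ℝ) (T : ℝ≥0) (φ : ℝ → ℝ) : ℝ :=
  ∫ p in Set.Icc (0 : ℝ) T ×ˢ Set.Icc (0 : ℝ) T, energyKernel H φ p

/-- `I` is (a version of) the stochastic integral `∫₀ᵀ φ(s) dB(s)`: the `L²(Ω)`-limit of the
elementary integrals of step functions converging to `φ` in `𝓗([0,T])`. -/
def IsWienerIntegral (P : Measure Ω) (H : ℝ) (T : ℝ≥0) (φ : ℝ → ℝ) (B : ℝ≥0 → Ω → ℂ)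
    (I : Ω → ℂ) : Prop :=
  Measurable φ ∧
  IntegrableOn (energyKernel H φ) (Set.Icc (0 : ℝ) T ×ˢ Set.Icc (0 : ℝ) T) ∧
  MemLp I 2 P ∧
  ∃ σ : ℕ → StepFun T,
    Tendsto (fun n => energy H T (fun s => φ s - (σ n).eval s)) atTop (𝓝 0) ∧
    Tendsto (fun n => eLpNorm (fun ω => I ω - (σ n).integral B ω) 2 P) atTop (𝓝 0)

/-! ### The initial field -/

/-- The harmonic coefficient `u_{0,ℓ m} = ∫_{𝕊²} u₀(x) conj Y_{ℓ m}(x) dν(x)`. -/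
def initCoeff (u₀ : S2 → Ω → ℝ) (l : ℕ) (m : ℤ) (ω : Ω) : ℂ :=
  ∫ x, (u₀ x ω : ℂ) * conj (sphHarm l m x) ∂surfaceMeasure

/-- The angular power spectrum of an isotropic field `u₀`: `D_ℓ = 𝔼|u_{0,ℓ m}|²`, which for an
isotropic field does not depend on `m`; it is read off at `m = 0`. -/
def angularPower (P : Measure Ω) (u₀ : S2 → Ω → ℝ) (l : ℕ) : ℝ :=
  ∫ ω, ‖initCoeff u₀ l 0 ω‖ ^ 2 ∂P

/-- Isotropy of the second moments: `𝔼[Z(x) Z(y)] = 𝔼[Z(gx) Z(gy)]` for all `g ∈ SO(3)`. -/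
def IsWeaklyIsotropic (P : Measure Ω) (Z : S2 → Ω → ℝ) : Prop :=
  ∀ g : E3 ≃ₗᵢ[ℝ] E3, LinearMap.det (g.toLinearEquiv : E3 →ₗ[ℝ] E3) = 1 →
    ∀ x y x' y' : S2, (x' : E3) = g x → (y' : E3) = g y →
      ∫ ω, Z x ω * Z y ω ∂P = ∫ ω, Z x' ω * Z y' ω ∂P

/-- The assumption on the initial value: `u₀ ≡ 0`, or `u₀ ∈ L²(Ω × 𝕊²)` is a zero-mean isotropic
Gaussian field, independent of the noise, with `D_ℓ ≤ D₀ (ℓ + 1/2)^{-b}` for some `b > 4`.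
(Since all `C_ℓ > 0`, independence of the noise is independence of its coefficients `β_{ℓ m}`.) -/
def IsAdmissibleInit (P : Measure Ω) (β : ℕ → ℤ → ℝ≥0 → Ω → ℂ) (u₀ : S2 → Ω → ℝ) : Prop :=
  (∀ x ω, u₀ x ω = 0) ∨
  ((∀ x, Measurable (u₀ x)) ∧
    MemLp (fun p : Ω × S2 => u₀ p.2 p.1) 2 (P.prod surfaceMeasure) ∧
    IsGaussianProcess u₀ P ∧
    (∀ x, ∫ ω, u₀ x ω ∂P = 0) ∧
    IsWeaklyIsotropic P u₀ ∧
    IndepFun (fun (ω : Ω) (x : S2) => u₀ x ω)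
      (fun (ω : Ω) (q : HarmIdx × ℝ≥0) => β q.1.1.1 q.1.1.2 q.2 ω) P ∧
    ∃ b D₀ : ℝ, 4 < b ∧ 0 < D₀ ∧
      ∀ l : ℕ, angularPower P u₀ l ≤ D₀ * ((l : ℝ) + 1 / 2) ^ (-b))

/-! ### The mild solution -/

/-- The function `g_ℓ(t,s) = e^{-ℓ(ℓ+1)(t-s)} 1_{[0,t]}(s)`. -/
def heatKernelMode (l : ℕ) (t : ℝ≥0) (s : ℝ) : ℝ :=
  (Set.Icc (0 : ℝ) t).indicator
    (fun s => Real.exp (-((l : ℝ) * ((l : ℝ) + 1)) * ((t : ℝ) - s))) s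

/-- `u` is the mild solution on `[0,T] × 𝕊²` of `du = Δ_{𝕊²} u dt + dW^H`, `u(0) = u₀`:
`u(t,x) = ∑_ℓ ∑_m (e^{-ℓ(ℓ+1)t} u_{0,ℓ m} + √C_ℓ ∫₀ᵗ e^{-ℓ(ℓ+1)(t-s)} dβ_{ℓ m}(s)) Y_{ℓ m}(x)`,
where, for every `(t,x)`, the series over `ℓ` converges in `L²(Ω)`. Here `J l m t` is the
stochastic integral `∫₀ᵗ e^{-ℓ(ℓ+1)(t-s)} dβ_{ℓ m}(s)`. -/
def IsMildSolution (P : Measure Ω) (H : ℝ) (T : ℝ≥0) (C : ℕ → ℝ)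
    (β : ℕ → ℤ → ℝ≥0 → Ω → ℂ) (u₀ : S2 → Ω → ℝ) (u : ℝ≥0 → S2 → Ω → ℝ) : Prop :=
  (∀ t ≤ T, ∀ x, Measurable (u t x)) ∧
  ∃ J : ℕ → ℤ → ℝ≥0 → Ω → ℂ,
    (∀ (l : ℕ) (m : ℤ), |m| ≤ (l : ℤ) → ∀ t ≤ T,
      IsWienerIntegral P H T (heatKernelMode l t) (β l m) (J l m t)) ∧
    ∀ t ≤ T, ∀ x, Tendsto
      (fun L : ℕ => eLpNorm (fun ω => (u t x ω : ℂ) -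
        ∑ l ∈ Finset.range L, ∑ m ∈ Finset.Icc (-(l : ℤ)) (l : ℤ),
          ((Real.exp (-((l : ℝ) * ((l : ℝ) + 1)) * (t : ℝ)) : ℂ) * initCoeff u₀ l m ω +
            (Real.sqrt (C l) : ℂ) * J l m t ω) * sphHarm l m x) 2 P)
      atTop (𝓝 0)

/-- The σ-algebra generated by `u(s,x)`, `s ∈ [0,T]`, `t - s ≥ r`, at a fixed point `x`. -/
abbrev pastSigma (T : ℝ≥0) (u : ℝ≥0 → S2 → Ω → ℝ) (x : S2) (t : ℝ≥0) (r : ℝ) : MeasurableSpace Ω :=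
  ⨆ s ∈ {s : ℝ≥0 | s ≤ T ∧ r ≤ (t : ℝ) - (s : ℝ)}, MeasurableSpace.comap (u s x) inferInstance

/-- The exponent `η = H - max{(2-α)/4, 0}`. -/
def timeExponent (H α : ℝ) : ℝ := H - max ((2 - α) / 4) 0

end SphereHeat

end

/-! Fix `x`. The solution splits as `u(t,x) = N(t) + R(t)`, where `N(t) = ∑_ℓ √C_ℓ ∑_m Re(Y_{ℓ m}(x)
J_{ℓ m}(t))` lies in the centred Gaussian Hilbert space spanned by the noise and `R(t)` is, up to
null sets, a function of the initial field, which is independent of the noise. Let `D` be `N(t)`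
minus its projection on the closed span of the past values `N(s)`. Orthogonality in a Gaussian space
is independence, so `D` is independent of the past and of the initial field together, and the
conditional variance is at least `‖D‖²` (`le_condVar_of_indep`, `le_condVar_of_gaussian`). It
remains to bound from below the distance from `N(t)` to finite linear combinations of the past.

For one mode this is a deterministic estimate. Since `∫ (u-z)₊^{H-3/2} (v-z)₊^{H-3/2} dz` is a
multiple of `|u-v|^{2H-2}`, the Wiener integral of `φ` has, up to a constant factor, the same inner
products as the potential `z ↦ ∫ φ(u) (u-z)₊^{H-3/2} du` in `L²(ℝ)` (`fracPot_mul`,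
`inner_eq_of_tendsto_integralCurve`). The kernel is one-sided: an integrand supported in `[0,s]` has
a potential that vanishes beyond `s`. With `s ≤ t-r`, no combination of the past alters the
potential of `e^{-ℓ(ℓ+1)(t-·)} 1_{[0,t]}` on `(t-r,t)`, where it is at least `e^{-ℓ(ℓ+1)r}
(t-z)^{H-1/2}/(H-1/2)`. Squaring and integrating gives a constant times `e^{-2ℓ(ℓ+1)r} r^{2H}`
(`le_norm_sq_mode_sub`).

Different degrees `ℓ` are orthogonal, so the squared distances add up (`le_norm_sq_sub_sum`). The
sum over `m` contributes `(2ℓ+1)/(4π)` by the addition theorem on the diagonal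
(`sum_sq_norm_sphHarm`), whatever `x` is; hence the constants do not depend on `x`. For `α < 2` the
degrees `ℓ ≤ r^{-1/2}` keep the exponential bounded below, and `∑ C_ℓ (2ℓ+1)` over them is at least
of order `r^{-(2-α)/2}`; for `α ≥ 2` the single degree `ℓ = 0` suffices
(`HasPowerDecay.exists_le_sum`). Multiplying by `r^{2H}` gives `r^{2η}`. -/

noncomputable section

namespace SphereHeat

/-! ### The addition theorem for spherical harmonics on the diagonal -/

section Legendre

open Polynomial

/-- The differential equation satisfied by the derivatives of `(z² - 1)^ℓ`. -/
lemma iterate_derivative_sq_sub_one_pow (l n : ℕ) :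
    (X ^ 2 - 1 : ℝ[X]) * derivative^[n + 2] ((X ^ 2 - 1) ^ l) =
      C (2 * (l : ℝ) - 2 * n - 2) * X * derivative^[n + 1] ((X ^ 2 - 1) ^ l) +
        C ((n + 1) * (2 * (l : ℝ) - n)) * derivative^[n] ((X ^ 2 - 1) ^ l) := by
  -- The first-order equation of `f = (X² - 1)^ℓ`; the induction is just repeated differentiation of
  -- it.
  have h0 : (X ^ 2 - 1 : ℝ[X]) * derivative ((X ^ 2 - 1) ^ l) =
      C (2 * (l : ℝ)) * X * (X ^ 2 - 1) ^ l := by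
    rcases l with _ | l
    · simp
    · rw [derivative_pow]
      simp only [derivative_sub, derivative_X_pow, derivative_one, map_mul, map_natCast, map_ofNat,
        Nat.cast_ofNat, Nat.add_sub_cancel]
      ring
  induction n with
  | zero =>
    have h1 := congrArg derivative h0
    simp only [derivative_mul, derivative_C, derivative_X, derivative_sub, derivative_X_pow,
      derivative_one] at h1
    simp only [Function.iterate_succ_apply', Function.iterate_zero, id]
    simp only [map_sub, map_mul, map_add, map_natCast, map_one, map_ofNat, Nat.cast_zero,
      map_zero, Nat.cast_ofNat] at h1 ⊢
    linear_combination h1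
  | succ n ih =>
    have h1 := congrArg derivative ih
    simp only [derivative_mul, derivative_C, derivative_X, derivative_sub, derivative_X_pow,
      derivative_one, derivative_add, ← Function.iterate_succ_apply' derivative] at h1
    simp only [map_sub, map_mul, map_add, map_natCast, map_one, map_ofNat, Nat.cast_add,
      Nat.cast_one, Nat.cast_ofNat] at h1 ⊢
    have e1 : n + 1 + 2 = (n + 2).succ := by omega
    have e2 : n + 1 + 1 = (n + 1).succ := by omega
    rw [e1, e2]
    simp only [Nat.succ_eq_add_one] at h1 ⊢
    linear_combination h1

/-- Expanded at `1`, `(X² - 1)^ℓ` becomes `(X + 2)^ℓ X^ℓ`, whose coefficient of `X^ℓ` is `2^ℓ`; the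
`ℓ`-th derivative at `1` is `ℓ!` times this. -/
lemma legendre_eval_one (l : ℕ) : (legendre l).eval 1 = 1 := by
  have h1 : (derivative^[l] ((X ^ 2 - 1 : ℝ[X]) ^ l)).eval 1 = l.factorial * 2 ^ l := by
    have h2 : derivative^[l] ((X ^ 2 - 1 : ℝ[X]) ^ l) =
        l.factorial • hasseDeriv l ((X ^ 2 - 1 : ℝ[X]) ^ l) := by
      rw [← factorial_smul_hasseDeriv]; rfl
    have h3 : taylor (1 : ℝ) ((X ^ 2 - 1 : ℝ[X]) ^ l) = (X + 2) ^ l * X ^ l := by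
      rw [taylor_pow, ← mul_pow]
      congr 1
      simp [taylor_apply]
      ring
    rw [h2, eval_smul, ← taylor_coeff, h3, coeff_mul_X_pow', if_pos le_rfl, Nat.sub_self,
      coeff_zero_eq_eval_zero]
    simp
  rw [legendre, eval_mul, eval_C, h1]
  have := Nat.factorial_ne_zero l
  field_simp

lemma iterate_derivative_legendre (l m : ℕ) : derivative^[m] (legendre l) =
    C ((2 ^ l * (l.factorial : ℝ))⁻¹) * derivative^[l + m] ((X ^ 2 - 1) ^ l) := by
  rw [legendre, iterate_derivative_C_mul, ← Function.iterate_add_apply, add_comm m l]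

/-- The Legendre equation, differentiated `m` times. -/
lemma legendre_ode (l m : ℕ) :
    (X ^ 2 - 1 : ℝ[X]) * derivative^[m + 2] (legendre l) =
      - C (2 * (m + 1 : ℝ)) * X * derivative^[m + 1] (legendre l) +
        C ((l + m + 1) * ((l : ℝ) - m)) * derivative^[m] (legendre l) := by
  have h := iterate_derivative_sq_sub_one_pow l (l + m)
  simp only [iterate_derivative_legendre, ← add_assoc]
  simp only [map_sub, map_mul, map_add, map_natCast, map_one, map_ofNat, Nat.cast_add] at h ⊢
  linear_combination (C ((2 ^ l * (l.factorial : ℝ))⁻¹)) * h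

lemma iterate_derivative_legendre_eq_zero (l : ℕ) : derivative^[l + 1] (legendre l) = 0 := by
  rw [iterate_derivative_legendre, iterate_derivative_eq_zero, mul_zero]
  have : ((X ^ 2 - 1 : ℝ[X]) ^ l).natDegree ≤ l * 2 := by
    refine natDegree_pow_le_of_le l ?_
    compute_degree
  omega

/-- The weights `(ℓ-m)!/(ℓ+m)!`. -/
def harmWeight (l m : ℕ) : ℝ := ((l - m).factorial : ℝ) / ((l + m).factorial : ℝ)

lemma harmWeight_nonneg (l m : ℕ) : 0 ≤ harmWeight l m := by unfold harmWeight; positivity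

lemma harmWeight_zero (l : ℕ) : harmWeight l 0 = 1 := by
  have := Nat.factorial_ne_zero l
  simp [harmWeight, this]

/-- The factor `(ℓ+m+1)(ℓ-m)` is the zeroth-order coefficient in `legendre_ode`; this match makes
the addition sum telescope. -/
lemma harmWeight_succ_mul {l m : ℕ} (h : m < l) :
    harmWeight l (m + 1) * ((l + m + 1) * ((l : ℝ) - m)) = harmWeight l m := by
  have h1 : ((l - m).factorial : ℝ) = ((l : ℝ) - m) * ((l - (m + 1)).factorial : ℝ) := by
    obtain ⟨k, rfl⟩ : ∃ k, l = m + 1 + k := ⟨l - (m + 1), by omega⟩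
    have e1 : m + 1 + k - m = k + 1 := by omega
    have e2 : m + 1 + k - (m + 1) = k := by omega
    rw [e1, e2, Nat.factorial_succ]
    push_cast
    ring
  have h2 : ((l + (m + 1)).factorial : ℝ) = ((l : ℝ) + m + 1) * ((l + m).factorial : ℝ) := by
    rw [← add_assoc, Nat.factorial_succ]
    push_cast
    ring
  have h3 : ((l + m).factorial : ℝ) ≠ 0 := by positivity
  have h4 : (l : ℝ) + m + 1 ≠ 0 := by positivity
  rw [harmWeight, harmWeight, h1, h2]
  field_simp

/-- The polynomial `P_ℓ² + 2 ∑_{m=1}^n (ℓ-m)!/(ℓ+m)! (1-z²)^m (P_ℓ^{(m)})²`. -/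
def additionPoly (l n : ℕ) : ℝ[X] :=
  legendre l ^ 2 + ∑ m ∈ Finset.range n, C (2 * harmWeight l (m + 1)) *
    ((1 - X ^ 2) ^ (m + 1) * (derivative^[m + 1] (legendre l)) ^ 2)

/-- The derivative telescopes. Differentiating the new summand gives two copies of `(1-X²)^(n+1)
P^(n+1) P^(n+2)` and a term with the factor `X`. By the Legendre equation one copy cancels that term
and the derivative left over from the previous stage. -/
lemma derivative_additionPoly (l n : ℕ) (hn : n ≤ l) : derivative (additionPoly l n) =
    C (2 * harmWeight l n) *
      ((1 - X ^ 2) ^ n * derivative^[n] (legendre l) * derivative^[n + 1] (legendre l)) := by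
  induction n with
  | zero =>
    simp only [additionPoly, Finset.range_zero, Finset.sum_empty, add_zero, harmWeight_zero,
      derivative_pow, Function.iterate_succ_apply', Function.iterate_zero, id]
    simp [mul_assoc]
  | succ n ih =>
    have h := ih (by omega)
    have e : additionPoly l (n + 1) = additionPoly l n + C (2 * harmWeight l (n + 1)) *
        ((1 - X ^ 2) ^ (n + 1) * (derivative^[n + 1] (legendre l)) ^ 2) := by
      simp only [additionPoly, Finset.sum_range_succ]
      ring
    rw [e, derivative_add, h, ← harmWeight_succ_mul (by omega : n < l)]
    have hode := legendre_ode l n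
    have hd : derivative (derivative^[n + 1] (legendre l)) = derivative^[n + 2] (legendre l) :=
      (Function.iterate_succ_apply' ..).symm
    simp only [derivative_mul, derivative_C, derivative_pow, derivative_sub, derivative_one,
      derivative_X, hd]
    simp only [map_sub, map_mul, map_add, map_natCast, map_one, map_ofNat, Nat.cast_add,
      Nat.cast_ofNat, Nat.add_sub_cancel, Nat.cast_one] at hode ⊢
    generalize derivative^[n + 2] (legendre l) = p2 at *
    generalize derivative^[n + 1] (legendre l) = p1 at *
    generalize derivative^[n] (legendre l) = p0 at *
    simp only [pow_succ] at *
    linear_combination (-2 * C (harmWeight l (n + 1)) * (1 - X * X) ^ n * p1) * hode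

/-- At `n = ℓ` the telescoped derivative contains `P_ℓ^(ℓ+1) = 0`, so the polynomial is constant; at
`1` every factor `1 - X²` vanishes and only `P_ℓ(1)² = 1` is left. -/
lemma additionPoly_self (l : ℕ) : additionPoly l l = 1 := by
  have h : derivative (additionPoly l l) = 0 := by
    rw [derivative_additionPoly l l le_rfl, iterate_derivative_legendre_eq_zero]
    simp
  rw [eq_C_of_derivative_eq_zero h]
  have h1 : (additionPoly l l).eval 1 = 1 := by
    simp [additionPoly, legendre_eval_one, eval_finsetSum]
  have h2 := congrArg (eval 1) (eq_C_of_derivative_eq_zero h)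
  rw [h1, eval_C] at h2
  rw [← h2, C_1]

end Legendre

lemma sq_norm_sphHarmNonneg (l m : ℕ) (x : S2) : ‖sphHarmNonneg l m x‖ ^ 2 =
    (2 * l + 1) / (4 * Real.pi) * (harmWeight l m * ((1 - ((x : E3) 2) ^ 2) ^ m *
      (((Polynomial.derivative^[m]) (legendre l)).eval ((x : E3) 2)) ^ 2)) := by
  have hx : (x : E3) 0 ^ 2 + (x : E3) 1 ^ 2 = 1 - (x : E3) 2 ^ 2 := by
    have h : ‖(x : E3)‖ = 1 := by simp
    have h2 := EuclideanSpace.norm_sq_eq (x : E3)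
    rw [h, Fin.sum_univ_three] at h2
    simp only [Real.norm_eq_abs, sq_abs] at h2
    linarith
  have hn : ‖((x : E3) 0 : ℂ) + Complex.I * ((x : E3) 1 : ℂ)‖ ^ 2 = 1 - (x : E3) 2 ^ 2 := by
    rw [← Complex.normSq_eq_norm_sq, mul_comm, Complex.normSq_add_mul_I, hx]
  have hw : 0 ≤ (2 * (l : ℝ) + 1) / (4 * Real.pi) * harmWeight l m :=
    mul_nonneg (by positivity) (harmWeight_nonneg l m)
  simp only [sphHarmNonneg, norm_mul, norm_pow, norm_neg, norm_one, one_pow, one_mul, mul_pow,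
    Complex.norm_real, Real.norm_eq_abs, sq_abs]
  rw [← pow_mul, mul_comm m 2, pow_mul, hn]
  change Real.sqrt ((2 * (l : ℝ) + 1) / (4 * Real.pi) * harmWeight l m) ^ 2 * _ * _ = _
  rw [Real.sq_sqrt hw]
  ring

lemma norm_sphHarm (l : ℕ) (m : ℤ) (x : S2) :
    ‖sphHarm l m x‖ = ‖sphHarmNonneg l m.natAbs x‖ := by
  unfold sphHarm
  split_ifs
  · rfl
  · simp

/-- The sum over `-ℓ ≤ m ≤ ℓ` of an even function. -/
lemma sum_Icc_natAbs (l : ℕ) (f : ℕ → ℝ) :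
    ∑ m ∈ Finset.Icc (-(l : ℤ)) (l : ℤ), f m.natAbs =
      f 0 + ∑ m ∈ Finset.range l, 2 * f (m + 1) := by
  induction l with
  | zero => simp
  | succ l ih =>
    have h : Finset.Icc (-((l + 1 : ℕ) : ℤ)) ((l + 1 : ℕ) : ℤ) =
        insert (-((l + 1 : ℕ) : ℤ)) (insert ((l + 1 : ℕ) : ℤ) (Finset.Icc (-(l : ℤ)) (l : ℤ))) := by
      ext m
      simp only [Finset.mem_Icc, Finset.mem_insert]
      push_cast
      omega
    rw [h, Finset.sum_insert, Finset.sum_insert, ih, Finset.sum_range_succ, Int.natAbs_neg,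
      Int.natAbs_natCast]
    · ring
    · simp
    · simp only [Finset.mem_insert, Finset.mem_Icc]
      push_cast
      omega

/-- The addition theorem on the diagonal: `∑_m |Y_{ℓ m}(x)|² = (2ℓ+1)/(4π)`. -/
lemma sum_sq_norm_sphHarm (l : ℕ) (x : S2) :
    ∑ m ∈ Finset.Icc (-(l : ℤ)) (l : ℤ), ‖sphHarm l m x‖ ^ 2 = (2 * l + 1) / (4 * Real.pi) := by
  simp only [norm_sphHarm]
  rw [sum_Icc_natAbs l (fun m => ‖sphHarmNonneg l m x‖ ^ 2)]
  simp only [sq_norm_sphHarmNonneg]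
  have h := congrArg (Polynomial.eval ((x : E3) 2)) (additionPoly_self l)
  simp only [additionPoly, Polynomial.eval_add, Polynomial.eval_pow, Polynomial.eval_finsetSum,
    Polynomial.eval_mul, Polynomial.eval_C, Polynomial.eval_sub, Polynomial.eval_one,
    Polynomial.eval_X] at h
  have h2 := congrArg (fun z : ℝ => (2 * (l : ℝ) + 1) / (4 * Real.pi) * z) h
  rw [mul_one, mul_add, Finset.mul_sum] at h2
  rw [harmWeight_zero, Function.iterate_zero, id, pow_zero, one_mul, one_mul]
  refine Eq.trans ?_ h2
  refine congrArg₂ (· + ·) rfl (Finset.sum_congr rfl fun m _ => ?_)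
  ring

/-! ### The one-sided fractional kernel -/

/-- The kernel `y ↦ y₊^{H - 3/2}`. -/
def fracKernel (H y : ℝ) : ℝ := (Set.Ioi (0 : ℝ)).indicator (fun y => y ^ (H - 3 / 2)) y

lemma fracKernel_nonneg (H y : ℝ) : 0 ≤ fracKernel H y :=
  Set.indicator_nonneg (fun _ hy => Real.rpow_nonneg (le_of_lt hy) _) y

lemma fracKernel_of_pos {H y : ℝ} (hy : 0 < y) : fracKernel H y = y ^ (H - 3 / 2) :=
  Set.indicator_of_mem (Set.mem_Ioi.2 hy) _

lemma fracKernel_of_nonpos {H y : ℝ} (hy : y ≤ 0) : fracKernel H y = 0 :=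
  Set.indicator_of_notMem (by simpa using hy) _

@[fun_prop]
lemma measurable_fracKernel (H : ℝ) : Measurable (fracKernel H) :=
  (measurable_id.pow_const _).indicator measurableSet_Ioi

lemma fracKernel_mul (H : ℝ) {d : ℝ} (hd : 0 < d) (y : ℝ) :
    fracKernel H (d * y) = d ^ (H - 3 / 2) * fracKernel H y := by
  rcases le_or_gt y 0 with hy | hy
  · rw [fracKernel_of_nonpos hy, fracKernel_of_nonpos (mul_nonpos_of_nonneg_of_nonpos hd.le hy),
      mul_zero]
  · rw [fracKernel_of_pos hy, fracKernel_of_pos (mul_pos hd hy), Real.mul_rpow hd.le hy.le]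

lemma integrableOn_fracKernel {H : ℝ} (hH : 1 / 2 < H) (a b z : ℝ) :
    IntegrableOn (fun u => fracKernel H (u - z)) (Set.Icc a b) := by
  rcases lt_or_ge b a with h | h
  · simp [h]
  have h1 : IntervalIntegrable (fun y : ℝ => y ^ (H - 3 / 2)) volume (a - z) (b - z) :=
    intervalIntegral.intervalIntegrable_rpow' (by linarith)
  have h2 : IntervalIntegrable (fracKernel H) volume (a - z) (b - z) := by
    rw [intervalIntegrable_iff_integrableOn_Ioc_of_le (by linarith)] at h1 ⊢
    exact h1.indicator measurableSet_Ioi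
  have h3 := h2.comp_sub_right z
  rw [sub_add_cancel, sub_add_cancel, intervalIntegrable_iff_integrableOn_Icc_of_le h] at h3
  exact h3

/-- The constant `∫ y₊^{H-3/2} (1+y)₊^{H-3/2} dy`. -/
def fracConst (H : ℝ) : ℝ := ∫ y, fracKernel H y * fracKernel H (y + 1)

/-- Near `0` the first factor dominates, with exponent `H - 3/2 > -1`; at infinity the product is at
most `y^(2H-3)`, and `2H - 3 < -1` is exactly `H < 1`. -/
lemma integrable_fracConst {H : ℝ} (hH : 1 / 2 < H) (hH1 : H < 1) :
    Integrable (fun y => fracKernel H y * fracKernel H (y + 1)) := by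
  have hm : Measurable (fun y => fracKernel H y * fracKernel H (y + 1)) := by fun_prop
  have hsplit : (Set.univ : Set ℝ) = Set.Iic 0 ∪ (Set.Icc 0 1 ∪ Set.Ioi 1) := by
    ext y
    simp only [Set.mem_univ, Set.mem_union, Set.mem_Iic, Set.mem_Icc, Set.mem_Ioi, true_iff]
    rcases le_or_gt y 0 with h | h
    · exact Or.inl h
    · rcases le_or_gt y 1 with h' | h'
      · exact Or.inr (Or.inl ⟨h.le, h'⟩)
      · exact Or.inr (Or.inr h')
  rw [← integrableOn_univ, hsplit]
  refine IntegrableOn.union ?_ (IntegrableOn.union ?_ ?_)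
  · refine IntegrableOn.congr_fun (f := fun _ => (0 : ℝ)) integrableOn_zero (fun y hy => ?_) measurableSet_Iic
    rw [fracKernel_of_nonpos hy, zero_mul]
  · have h := integrableOn_fracKernel hH 0 1 0
    refine Integrable.mono' h hm.aestronglyMeasurable ?_
    refine (ae_restrict_iff' measurableSet_Icc).2 (Eventually.of_forall fun y hy => ?_)
    rw [Real.norm_of_nonneg (mul_nonneg (fracKernel_nonneg _ _) (fracKernel_nonneg _ _)), sub_zero]
    refine mul_le_of_le_one_right (fracKernel_nonneg _ _) ?_
    rw [fracKernel_of_pos (by linarith [hy.1])]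
    exact Real.rpow_le_one_of_one_le_of_nonpos (by linarith [hy.1]) (by linarith)
  · have h : IntegrableOn (fun y : ℝ => y ^ (2 * H - 3)) (Set.Ioi 1) :=
      integrableOn_Ioi_rpow_of_lt (by linarith) one_pos
    refine Integrable.mono' h hm.aestronglyMeasurable ?_
    refine (ae_restrict_iff' measurableSet_Ioi).2 (Eventually.of_forall fun y hy => ?_)
    have hy0 : (0 : ℝ) < y := lt_trans one_pos hy
    rw [Real.norm_of_nonneg (mul_nonneg (fracKernel_nonneg _ _) (fracKernel_nonneg _ _)),
      fracKernel_of_pos hy0, fracKernel_of_pos (by linarith),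
      show 2 * H - 3 = (H - 3 / 2) + (H - 3 / 2) by ring, Real.rpow_add hy0]
    refine mul_le_mul_of_nonneg_left ?_ (Real.rpow_nonneg hy0.le _)
    exact Real.rpow_le_rpow_of_nonpos hy0 (by linarith) (by linarith)

lemma fracConst_pos {H : ℝ} (hH : 1 / 2 < H) (hH1 : H < 1) : 0 < fracConst H := by
  have h0 : 0 ≤ fun y => fracKernel H y * fracKernel H (y + 1) :=
    fun y => mul_nonneg (fracKernel_nonneg _ _) (fracKernel_nonneg _ _)
  rw [fracConst, integral_pos_iff_support_of_nonneg h0 (integrable_fracConst hH hH1)]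
  refine lt_of_lt_of_le (b := volume (Set.Ioi (0 : ℝ))) (by simp) (measure_mono fun y hy => ?_)
  have hy0 : (0 : ℝ) < y := hy
  rw [Function.mem_support, fracKernel_of_pos hy0, fracKernel_of_pos (by linarith)]
  positivity

/-- The composition formula `∫ (u-z)₊^{H-3/2} (v-z)₊^{H-3/2} dz = κ |u-v|^{2H-2}`, for `u < v`. -/
lemma integral_fracKernel_mul_aux {H : ℝ} (hH : 1 / 2 < H) (hH1 : H < 1) {u v : ℝ} (huv : u < v) :
    Integrable (fun z => fracKernel H (u - z) * fracKernel H (v - z)) ∧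
      ∫ z, fracKernel H (u - z) * fracKernel H (v - z) =
        fracConst H * |u - v| ^ (2 * H - 2) := by
  set d := v - u with hd
  have hd0 : 0 < d := sub_pos.2 huv
  set F : ℝ → ℝ := fun w => fracKernel H w * fracKernel H (w + d) with hF
  have e1 : (fun z => fracKernel H (u - z) * fracKernel H (v - z)) = fun z => F (u - z) := by
    funext z
    simp only [hF, hd]
    congr 2
    ring
  -- Scaling by the gap `d = v - u`: homogeneity of the two kernels gives `d^(2H-3)`, and the change
  -- of variables supplies the missing power of `d`.
  have e2 : (fun y => F (d * y)) =
      fun y => d ^ (2 * H - 3) * (fracKernel H y * fracKernel H (y + 1)) := by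
    funext y
    simp only [hF]
    rw [show d * y + d = d * (y + 1) by ring, fracKernel_mul H hd0, fracKernel_mul H hd0,
      show 2 * H - 3 = (H - 3 / 2) + (H - 3 / 2) by ring, Real.rpow_add hd0]
    ring
  have hi : Integrable F := by
    rw [← integrable_comp_mul_left_iff F hd0.ne', e2]
    exact (integrable_fracConst hH hH1).const_mul _
  refine ⟨?_, ?_⟩
  · rw [e1]
    exact hi.comp_sub_left u
  · rw [e1, integral_sub_left_eq_self F volume u]
    have h := Measure.integral_comp_mul_left F d
    rw [e2, integral_const_mul] at h
    change _ * fracConst H = _ at h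
    rw [abs_of_pos (inv_pos.2 hd0), smul_eq_mul] at h
    have h2 : ∫ y, F y = d * (d ^ (2 * H - 3) * fracConst H) := by
      rw [h]; field_simp
    rw [h2, abs_sub_comm, abs_of_pos (sub_pos.2 huv), ← hd,
      show 2 * H - 2 = (2 * H - 3) + 1 by ring, Real.rpow_add_one hd0.ne']
    ring

lemma integral_fracKernel_mul {H : ℝ} (hH : 1 / 2 < H) (hH1 : H < 1) {u v : ℝ} (huv : u ≠ v) :
    Integrable (fun z => fracKernel H (u - z) * fracKernel H (v - z)) ∧
      ∫ z, fracKernel H (u - z) * fracKernel H (v - z) =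
        fracConst H * |u - v| ^ (2 * H - 2) := by
  rcases lt_or_gt_of_ne huv with h | h
  · exact integral_fracKernel_mul_aux hH hH1 h
  · rw [abs_sub_comm]
    simp only [mul_comm (fracKernel H (u - _))]
    exact integral_fracKernel_mul_aux hH hH1 h

/-! ### The energy of an interval -/

lemma integral_abs_sub_rpow {s : ℝ} (hs : -1 < s) {a b u : ℝ} (hu : u ∈ Set.Icc a b) :
    IntegrableOn (fun v => |u - v| ^ s) (Set.Icc a b) ∧
      ∫ v in Set.Icc a b, |u - v| ^ s = ((u - a) ^ (s + 1) + (b - u) ^ (s + 1)) / (s + 1) := by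
  have hs1 : s + 1 ≠ 0 := by linarith
  have i0 : ∀ c d : ℝ, IntervalIntegrable (fun y : ℝ => y ^ s) volume c d :=
    fun c d => intervalIntegral.intervalIntegrable_rpow' hs
  have i1 : IntervalIntegrable (fun v => (u - v) ^ s) volume a u := by
    have h := (i0 (u - a) (u - u)).comp_sub_left u
    simpa using h
  have i2 : IntervalIntegrable (fun v => (v - u) ^ s) volume u b := by
    have h := (i0 (u - u) (b - u)).comp_sub_right u
    simpa using h
  have c1 : Set.EqOn (fun v => (u - v) ^ s) (fun v => |u - v| ^ s) (Set.uIcc a u) := by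
    intro v hv
    rw [Set.uIcc_of_le hu.1] at hv
    simp only
    rw [abs_of_nonneg (by linarith [hv.2])]
  have c2 : Set.EqOn (fun v => (v - u) ^ s) (fun v => |u - v| ^ s) (Set.uIcc u b) := by
    intro v hv
    rw [Set.uIcc_of_le hu.2] at hv
    simp only
    rw [abs_sub_comm, abs_of_nonneg (by linarith [hv.1])]
  have j1 := i1.congr (c1.mono Set.uIoc_subset_uIcc)
  have j2 := i2.congr (c2.mono Set.uIoc_subset_uIcc)
  have hab : a ≤ b := hu.1.trans hu.2
  refine ⟨(intervalIntegrable_iff_integrableOn_Icc_of_le hab).1 (j1.trans j2), ?_⟩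
  rw [integral_Icc_eq_integral_Ioc, ← intervalIntegral.integral_of_le hab,
    ← intervalIntegral.integral_add_adjacent_intervals j1 j2,
    ← intervalIntegral.integral_congr c1, ← intervalIntegral.integral_congr c2]
  have k1 : ∫ v in a..u, (u - v) ^ s = (u - a) ^ (s + 1) / (s + 1) := by
    rw [intervalIntegral.integral_comp_sub_left (fun y => y ^ s) u, integral_rpow (Or.inl hs)]
    simp [Real.zero_rpow hs1]
  have k2 : ∫ v in u..b, (v - u) ^ s = (b - u) ^ (s + 1) / (s + 1) := by
    rw [intervalIntegral.integral_comp_sub_right (fun y => y ^ s) u, integral_rpow (Or.inl hs)]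
    simp [Real.zero_rpow hs1]
  rw [k1, k2]
  ring

lemma integrableOn_abs_sub_rpow {s : ℝ} (hs : -1 < s) (a b : ℝ) :
    IntegrableOn (fun p : ℝ × ℝ => |p.1 - p.2| ^ s) (Set.Icc a b ×ˢ Set.Icc a b) := by
  have hm : Measurable (fun p : ℝ × ℝ => |p.1 - p.2| ^ s) := by fun_prop
  rw [IntegrableOn, Measure.volume_eq_prod, ← Measure.prod_restrict,
    integrable_prod_iff hm.aestronglyMeasurable]
  refine ⟨(ae_restrict_iff' measurableSet_Icc).2 (Eventually.of_forall fun u hu =>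
    (integral_abs_sub_rpow hs hu).1), ?_⟩
  have hc : ContinuousOn (fun u : ℝ => ((u - a) ^ (s + 1) + (b - u) ^ (s + 1)) / (s + 1))
      (Set.Icc a b) := by
    refine ContinuousOn.div_const (ContinuousOn.add ?_ ?_) _
    · exact (by fun_prop : ContinuousOn (fun u : ℝ => u - a) _).rpow_const
        fun u _ => Or.inr (by linarith)
    · exact (by fun_prop : ContinuousOn (fun u : ℝ => b - u) _).rpow_const
        fun u _ => Or.inr (by linarith)
  refine (hc.integrableOn_compact isCompact_Icc).congr_fun (fun u hu => ?_) measurableSet_Icc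
  simp only [Real.norm_of_nonneg (Real.rpow_nonneg (abs_nonneg _) s)]
  exact (integral_abs_sub_rpow hs hu).2.symm

lemma setIntegral_abs_sub_rpow {s : ℝ} (hs : -1 < s) {a b : ℝ} (hab : a ≤ b) :
    ∫ p in Set.Icc a b ×ˢ Set.Icc a b, |p.1 - p.2| ^ s =
      2 * (b - a) ^ (s + 2) / ((s + 1) * (s + 2)) := by
  have hs1 : s + 1 ≠ 0 := by linarith
  have hs2 : s + 1 + 1 ≠ 0 := by linarith
  rw [Measure.volume_eq_prod, setIntegral_prod _ (integrableOn_abs_sub_rpow hs a b)]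
  rw [setIntegral_congr_fun measurableSet_Icc fun u hu => (integral_abs_sub_rpow hs hu).2,
    integral_Icc_eq_integral_Ioc, ← intervalIntegral.integral_of_le hab]
  have i0 : ∀ c d : ℝ, IntervalIntegrable (fun y : ℝ => y ^ (s + 1)) volume c d :=
    fun c d => intervalIntegral.intervalIntegrable_rpow' (by linarith)
  have i1 : IntervalIntegrable (fun v => (v - a) ^ (s + 1)) volume a b := by
    have h := (i0 (a - a) (b - a)).comp_sub_right a
    simpa using h
  have i2 : IntervalIntegrable (fun v => (b - v) ^ (s + 1)) volume a b := by
    have h := (i0 (b - a) (b - b)).comp_sub_left b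
    simpa using h
  rw [intervalIntegral.integral_div, intervalIntegral.integral_add i1 i2,
    intervalIntegral.integral_comp_sub_left (fun y => y ^ (s + 1)) b,
    intervalIntegral.integral_comp_sub_right (fun y => y ^ (s + 1)) a,
    sub_self, sub_self, integral_rpow (Or.inl (by linarith)), Real.zero_rpow hs2,
    show s + 1 + 1 = s + 2 by ring] at *
  field_simp
  ring

/-! ### Fractional potentials of bounded functions on `[0,T]` -/

/-- Bounded measurable functions that vanish outside `[0,T]`. -/
structure IsTestFun (T : ℝ) (φ : ℝ → ℝ) : Prop where
  measurable : Measurable φ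
  bdd : ∃ c : ℝ, ∀ u, |φ u| ≤ c
  eq_zero : ∀ u, u ∉ Set.Icc 0 T → φ u = 0

namespace IsTestFun

variable {T : ℝ} {φ ψ : ℝ → ℝ}

lemma zero (T : ℝ) : IsTestFun T (fun _ => 0) := ⟨measurable_const, ⟨0, by simp⟩, by simp⟩

lemma add (hφ : IsTestFun T φ) (hψ : IsTestFun T ψ) : IsTestFun T (fun u => φ u + ψ u) := by
  obtain ⟨m, ⟨c, hc⟩, h0⟩ := hφ
  obtain ⟨m', ⟨c', hc'⟩, h0'⟩ := hψ
  exact ⟨m.add m', ⟨c + c', fun u => (abs_add_le _ _).trans (add_le_add (hc u) (hc' u))⟩,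
    fun u hu => by rw [h0 u hu, h0' u hu, add_zero]⟩

lemma const_mul (hφ : IsTestFun T φ) (a : ℝ) : IsTestFun T (fun u => a * φ u) := by
  obtain ⟨m, ⟨c, hc⟩, h0⟩ := hφ
  refine ⟨m.const_mul a, ⟨|a| * c, fun u => ?_⟩, fun u hu => by rw [h0 u hu, mul_zero]⟩
  rw [abs_mul]
  exact mul_le_mul_of_nonneg_left (hc u) (abs_nonneg a)

lemma sub (hφ : IsTestFun T φ) (hψ : IsTestFun T ψ) : IsTestFun T (fun u => φ u - ψ u) := by
  simpa [sub_eq_add_neg] using hφ.add (hψ.const_mul (-1))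

lemma sum {ι : Type*} (s : Finset ι) {f : ι → ℝ → ℝ} (hf : ∀ i ∈ s, IsTestFun T (f i)) :
    IsTestFun T (fun u => ∑ i ∈ s, f i u) := by
  classical
  induction s using Finset.induction_on with
  | empty => simpa using zero T
  | insert i s hi ih =>
    simp only [Finset.sum_insert hi]
    exact (hf i (Finset.mem_insert_self i s)).add
      (ih fun j hj => hf j (Finset.mem_insert_of_mem hj))

lemma indicator_Icc {a b : ℝ} (ha : 0 ≤ a) (hb : b ≤ T) :
    IsTestFun T ((Set.Icc a b).indicator fun _ => (1 : ℝ)) := by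
  refine ⟨measurable_const.indicator measurableSet_Icc, ⟨1, fun u => ?_⟩, fun u hu => ?_⟩
  · by_cases h : u ∈ Set.Icc a b <;> simp [h]
  · exact Set.indicator_of_notMem (fun h => hu ⟨ha.trans h.1, h.2.trans hb⟩) _

lemma mono (hφ : IsTestFun T φ) {S : ℝ} (hS : T ≤ S) : IsTestFun S φ :=
  ⟨hφ.measurable, hφ.bdd, fun u hu => hφ.eq_zero u fun h => hu ⟨h.1, h.2.trans hS⟩⟩

lemma integrable_mul_fracKernel (hφ : IsTestFun T φ) {H : ℝ} (hH : 1 / 2 < H) (z : ℝ) :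
    Integrable (fun u => φ u * fracKernel H (u - z)) := by
  obtain ⟨m, ⟨c, hc⟩, h0⟩ := hφ
  have h1 : IntegrableOn (fun u => φ u * fracKernel H (u - z)) (Set.Icc 0 T) := by
    refine Integrable.mono' ((integrableOn_fracKernel hH 0 T z).const_mul c)
      (by fun_prop) (Eventually.of_forall fun u => ?_)
    rw [norm_mul, Real.norm_of_nonneg (fracKernel_nonneg _ _)]
    exact mul_le_mul_of_nonneg_right (hc u) (fracKernel_nonneg _ _)
  refine (integrableOn_iff_integrable_of_support_subset fun u hu => ?_).1 h1
  by_contra h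
  exact hu (by simp [h0 u h])

end IsTestFun

/-! ### The potential operator and its energy identity. -/

/-- The potential `∫ φ(u) (u-z)₊^{H-3/2} du`. -/
def fracPot (H : ℝ) (φ : ℝ → ℝ) (z : ℝ) : ℝ := ∫ u, φ u * fracKernel H (u - z)

lemma volume_diagonal : volume {p : ℝ × ℝ | p.1 = p.2} = 0 := by
  rw [Measure.volume_eq_prod, Measure.measure_prod_null
    (measurableSet_eq_fun measurable_fst measurable_snd)]
  refine Eventually.of_forall fun u => ?_
  have : (Prod.mk u ⁻¹' {p : ℝ × ℝ | p.1 = p.2}) = {u} := by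
    ext v; simp [eq_comm]
  simp only [this, measure_singleton, Pi.zero_apply]

section Potential

variable {H T : ℝ} {φ ψ : ℝ → ℝ}

/-- Fubini and the composition formula, which fails only on the null diagonal. Absolute
integrability reduces to that of `|u-v|^(2H-2)` on the square, since `φ` and `ψ` are bounded and
vanish outside `[0,T]`. -/
lemma fracPot_mul (hH : 1 / 2 < H) (hH1 : H < 1) (hφ : IsTestFun T φ) (hψ : IsTestFun T ψ) :
    Integrable (fun z => fracPot H φ z * fracPot H ψ z) ∧
      ∫ z, fracPot H φ z * fracPot H ψ z =
        fracConst H * ∫ p : ℝ × ℝ, φ p.1 * ψ p.2 * |p.1 - p.2| ^ (2 * H - 2) := by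
  set F : (ℝ × ℝ) × ℝ → ℝ := fun q =>
    φ q.1.1 * ψ q.1.2 * (fracKernel H (q.1.1 - q.2) * fracKernel H (q.1.2 - q.2)) with hF
  have mφ := hφ.measurable
  have mψ := hψ.measurable
  have hFm : Measurable F := by fun_prop
  have hne : ∀ᵐ p : ℝ × ℝ, p.1 ≠ p.2 := by
    rw [ae_iff]
    simpa using volume_diagonal
  have hbox : Integrable (fun p : ℝ × ℝ => |φ p.1| * |ψ p.2| * |p.1 - p.2| ^ (2 * H - 2)) := by
    obtain ⟨c, hc⟩ := hφ.bdd
    obtain ⟨c', hc'⟩ := hψ.bdd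
    have h1 : IntegrableOn (fun p : ℝ × ℝ => |φ p.1| * |ψ p.2| * |p.1 - p.2| ^ (2 * H - 2))
        (Set.Icc 0 T ×ˢ Set.Icc 0 T) := by
      refine Integrable.mono' ((integrableOn_abs_sub_rpow (s := 2 * H - 2) (by linarith)
        0 T).const_mul (c * c')) (by fun_prop) (Eventually.of_forall fun p => ?_)
      have hr := Real.rpow_nonneg (abs_nonneg (p.1 - p.2)) (2 * H - 2)
      rw [Real.norm_of_nonneg (by positivity)]
      exact mul_le_mul_of_nonneg_right (mul_le_mul (hc _) (hc' _) (abs_nonneg _)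
        ((abs_nonneg _).trans (hc 0))) hr
    refine (integrableOn_iff_integrable_of_support_subset fun p hp => ?_).1 h1
    by_contra h
    rw [Set.mem_prod, not_and_or] at h
    refine hp ?_
    rcases h with h | h
    · simp [hφ.eq_zero _ h]
    · simp [hψ.eq_zero _ h]
  have hFi : Integrable F ((volume : Measure (ℝ × ℝ)).prod volume) := by
    rw [integrable_prod_iff hFm.aestronglyMeasurable]
    refine ⟨hne.mono fun p hp => ((integral_fracKernel_mul hH hH1 hp).1.const_mul (φ p.1 * ψ p.2)), ?_⟩
    refine (hbox.const_mul (fracConst H)).congr (hne.mono fun p hp => ?_)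
    simp only [hF, norm_mul, Real.norm_eq_abs, abs_of_nonneg (fracKernel_nonneg H _)]
    rw [integral_const_mul, (integral_fracKernel_mul hH hH1 hp).2]
    ring
  have e1 : ∀ z, ∫ p, F (p, z) = fracPot H φ z * fracPot H ψ z := by
    intro z
    rw [fracPot, fracPot, ← integral_prod_mul, ← Measure.volume_eq_prod]
    refine integral_congr_ae (Eventually.of_forall fun p => ?_)
    simp only [hF]
    ring
  have e2 : ∫ p : ℝ × ℝ, ∫ z, F (p, z) =
      fracConst H * ∫ p : ℝ × ℝ, φ p.1 * ψ p.2 * |p.1 - p.2| ^ (2 * H - 2) := by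
    rw [← integral_const_mul]
    refine integral_congr_ae (hne.mono fun p hp => ?_)
    simp only [hF]
    rw [integral_const_mul, (integral_fracKernel_mul hH hH1 hp).2]
    ring
  refine ⟨?_, ?_⟩
  · have h := hFi.integral_prod_right
    simpa only [e1] using h
  · rw [← e2, integral_integral_swap hFi]
    simp only [e1]

lemma memLp_fracPot (hH : 1 / 2 < H) (hH1 : H < 1) (hφ : IsTestFun T φ) :
    MemLp (fracPot H φ) 2 := by
  have mφ := hφ.measurable
  have hm : AEStronglyMeasurable (fracPot H φ) := by
    have h : Measurable (fun q : ℝ × ℝ => φ q.2 * fracKernel H (q.2 - q.1)) := by fun_prop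
    exact (h.aestronglyMeasurable (μ := volume.prod volume)).integral_prod_right'
  rw [memLp_two_iff_integrable_sq hm]
  simpa only [sq] using (fracPot_mul hH hH1 hφ hφ).1

/-- The potential of `φ` as an element of `L²(ℝ)` (zero if it is not square integrable). -/
def fracL2 (H : ℝ) (φ : ℝ → ℝ) : Lp ℝ 2 (volume : Measure ℝ) :=
  open Classical in if h : MemLp (fracPot H φ) 2 volume then h.toLp else 0

lemma coeFn_fracL2 (hH : 1 / 2 < H) (hH1 : H < 1) (hφ : IsTestFun T φ) :
    fracL2 H φ =ᵐ[volume] fracPot H φ := by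
  rw [fracL2, dif_pos (memLp_fracPot hH hH1 hφ)]
  exact MemLp.coeFn_toLp _

lemma fracL2_congr_ae (h : φ =ᵐ[volume] ψ) : fracL2 H φ = fracL2 H ψ := by
  have : fracPot H φ = fracPot H ψ := by
    funext z
    exact integral_congr_ae (h.mono fun u hu => by simp only [hu])
  unfold fracL2
  rw [this]

lemma fracL2_add (hH : 1 / 2 < H) (hH1 : H < 1) (hφ : IsTestFun T φ) (hψ : IsTestFun T ψ) :
    fracL2 H (fun u => φ u + ψ u) = fracL2 H φ + fracL2 H ψ := by
  refine Lp.ext ?_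
  filter_upwards [coeFn_fracL2 hH hH1 hφ, coeFn_fracL2 hH hH1 hψ,
    coeFn_fracL2 hH hH1 (hφ.add hψ), Lp.coeFn_add (fracL2 H φ) (fracL2 H ψ)] with z h1 h2 h3 h4
  rw [h3, h4, Pi.add_apply, h1, h2, fracPot, fracPot, fracPot,
    ← integral_add (hφ.integrable_mul_fracKernel hH z) (hψ.integrable_mul_fracKernel hH z)]
  simp only [add_mul]

lemma fracL2_const_mul (hH : 1 / 2 < H) (hH1 : H < 1) (hφ : IsTestFun T φ) (a : ℝ) :
    fracL2 H (fun u => a * φ u) = a • fracL2 H φ := by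
  refine Lp.ext ?_
  filter_upwards [coeFn_fracL2 hH hH1 hφ, coeFn_fracL2 hH hH1 (hφ.const_mul a),
    Lp.coeFn_smul a (fracL2 H φ)] with z h1 h2 h3
  rw [h2, h3, Pi.smul_apply, h1, fracPot, fracPot, smul_eq_mul, ← integral_const_mul]
  simp only [mul_assoc]

lemma fracL2_sub (hH : 1 / 2 < H) (hH1 : H < 1) (hφ : IsTestFun T φ) (hψ : IsTestFun T ψ) :
    fracL2 H (fun u => φ u - ψ u) = fracL2 H φ - fracL2 H ψ := by
  have h := fracL2_add hH hH1 hφ (hψ.const_mul (-1))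
  rw [fracL2_const_mul hH hH1 hψ] at h
  simpa [sub_eq_add_neg] using h

lemma fracL2_sum (hH : 1 / 2 < H) (hH1 : H < 1) {ι : Type*} (s : Finset ι) {f : ι → ℝ → ℝ}
    (hf : ∀ i ∈ s, IsTestFun T (f i)) (a : ι → ℝ) :
    fracL2 H (fun u => ∑ i ∈ s, a i * f i u) = ∑ i ∈ s, a i • fracL2 H (f i) := by
  classical
  induction s using Finset.induction_on with
  | empty =>
    have := fracL2_const_mul hH hH1 (IsTestFun.zero T) 0
    simpa using this
  | insert i s hi ih =>
    have hs : ∀ j ∈ s, IsTestFun T (f j) := fun j hj => hf j (Finset.mem_insert_of_mem hj)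
    have h1 := hf i (Finset.mem_insert_self i s)
    simp only [Finset.sum_insert hi]
    rw [fracL2_add hH hH1 (h1.const_mul (a i))
      (IsTestFun.sum s fun j hj => (hs j hj).const_mul (a j)), fracL2_const_mul hH hH1 h1, ih hs]

lemma inner_fracL2 (hH : 1 / 2 < H) (hH1 : H < 1) (hφ : IsTestFun T φ) (hψ : IsTestFun T ψ) :
    inner ℝ (fracL2 H φ) (fracL2 H ψ) = ∫ z, fracPot H φ z * fracPot H ψ z := by
  rw [L2.inner_def]
  refine integral_congr_ae ?_
  filter_upwards [coeFn_fracL2 hH hH1 hφ, coeFn_fracL2 hH hH1 hψ] with z h1 h2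
  rw [h1, h2]
  simp [mul_comm]

/-- Turns convergence of step functions in energy into convergence of their potentials in `L²(ℝ)`.
-/
lemma norm_sq_fracL2 (hH : 1 / 2 < H) (hH1 : H < 1) {S : ℝ≥0} (hφ : IsTestFun S φ) :
    ‖fracL2 H φ‖ ^ 2 = fracConst H * energy H S φ := by
  rw [← real_inner_self_eq_norm_sq, inner_fracL2 hH hH1 hφ hφ, (fracPot_mul hH hH1 hφ hφ).2, energy]
  congr 1
  refine (setIntegral_eq_integral_of_forall_compl_eq_zero fun p hp => ?_).symm
  rw [Set.mem_prod, not_and_or] at hp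
  rcases hp with h | h
  · simp [hφ.eq_zero _ h]
  · simp [hφ.eq_zero _ h]

end Potential

lemma norm_sq_fracL2_Icc {H : ℝ} (hH : 1 / 2 < H) (hH1 : H < 1) {a b : ℝ≥0} (hab : a ≤ b) :
    ‖fracL2 H ((Set.Icc (a : ℝ) b).indicator fun _ => (1 : ℝ))‖ ^ 2 =
      fracConst H / (H * (2 * H - 1)) * ((b : ℝ) - a) ^ (2 * H) := by
  have hab' : (a : ℝ) ≤ b := hab
  rw [norm_sq_fracL2 hH hH1 (S := b) (IsTestFun.indicator_Icc a.coe_nonneg le_rfl), energy]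
  have e : ∀ p : ℝ × ℝ, energyKernel H ((Set.Icc (a : ℝ) b).indicator fun _ => (1 : ℝ)) p =
      (Set.Icc (a : ℝ) b ×ˢ Set.Icc (a : ℝ) b).indicator
        (fun p : ℝ × ℝ => |p.1 - p.2| ^ (2 * H - 2)) p := by
    intro p
    by_cases h1 : p.1 ∈ Set.Icc (a : ℝ) b <;> by_cases h2 : p.2 ∈ Set.Icc (a : ℝ) b <;>
      simp only [energyKernel, Set.indicator, Set.mem_prod, h1, h2, if_true, if_false, one_mul,
        mul_zero, zero_mul, and_self, and_false, false_and]
  simp only [e]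
  rw [setIntegral_indicator (measurableSet_Icc.prod measurableSet_Icc), Set.inter_eq_right.2,
    setIntegral_abs_sub_rpow (by linarith) hab']
  · have h1 : H ≠ 0 := by linarith
    have h2 : 2 * H - 1 ≠ 0 := by linarith
    rw [show 2 * H - 2 + 2 = 2 * H by ring, show 2 * H - 2 + 1 = 2 * H - 1 by ring]
    field_simp
  · have : Set.Icc (a : ℝ) b ⊆ Set.Icc 0 b := Set.Icc_subset_Icc_left a.coe_nonneg
    exact Set.prod_mono this this

/-! ### A model of fractional Brownian motion in `L²(ℝ)`, and the isometry. -/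

/-- The potential of `1_{[0,t]}`. -/
def fracInterval (H : ℝ) (t : ℝ≥0) : Lp ℝ 2 (volume : Measure ℝ) :=
  fracL2 H ((Set.Icc (0 : ℝ) t).indicator fun _ => (1 : ℝ))

lemma fracL2_Icc {H : ℝ} (hH : 1 / 2 < H) (hH1 : H < 1) {a b : ℝ≥0} (hab : a ≤ b) :
    fracL2 H ((Set.Icc (a : ℝ) b).indicator fun _ => (1 : ℝ)) =
      fracInterval H b - fracInterval H a := by
  have hab' : (a : ℝ) ≤ b := hab
  rw [fracInterval, fracInterval, ← fracL2_sub hH hH1 (T := b)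
    (IsTestFun.indicator_Icc le_rfl le_rfl) (IsTestFun.indicator_Icc le_rfl hab')]
  refine fracL2_congr_ae ?_
  -- The difference of the indicators of `[0,b]` and `[0,a]` is that of `(a,b]`, so the point `a`
  -- has to be discarded.
  have hne : ∀ᵐ u : ℝ, u ≠ a := by
    rw [ae_iff]; simp
  filter_upwards [hne] with u hu
  have ha := a.coe_nonneg
  by_cases h1 : u < 0
  · have h2 : ¬ (a : ℝ) ≤ u := by linarith
    simp [Set.indicator, h1.not_ge, h2]
  · push Not at h1
    rcases lt_or_gt_of_ne hu with h | h
    · simp [Set.indicator, h1, h.le, h.not_ge, (h.le.trans hab')]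
    · by_cases h3 : u ≤ b <;> simp [Set.indicator, h1, h.le, h.not_ge, h3]

/-- Polarisation of `‖f(t) - f(s)‖² = c |t-s|^{2H}`: the curve `fracInterval` realises the
covariance of fractional Brownian motion, up to a constant, without any probability. -/
lemma inner_fracInterval {H : ℝ} (hH : 1 / 2 < H) (hH1 : H < 1) (t s : ℝ≥0) :
    inner ℝ (fracInterval H t) (fracInterval H s) =
      fracConst H / (H * (2 * H - 1)) * fbmCov H t s := by
  have hn : ∀ t : ℝ≥0, ‖fracInterval H t‖ ^ 2 =
      fracConst H / (H * (2 * H - 1)) * (t : ℝ) ^ (2 * H) := by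
    intro t
    have h := norm_sq_fracL2_Icc hH hH1 (zero_le (a := t))
    simpa [fracInterval] using h
  have hd : ∀ t s : ℝ≥0, s ≤ t → ‖fracInterval H t - fracInterval H s‖ ^ 2 =
      fracConst H / (H * (2 * H - 1)) * |(t : ℝ) - s| ^ (2 * H) := by
    intro t s hst
    rw [← fracL2_Icc hH hH1 hst, norm_sq_fracL2_Icc hH hH1 hst,
      abs_of_nonneg (sub_nonneg.2 (by exact_mod_cast hst))]
  have hd' : ‖fracInterval H t - fracInterval H s‖ ^ 2 =
      fracConst H / (H * (2 * H - 1)) * |(t : ℝ) - s| ^ (2 * H) := by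
    rcases le_total s t with h | h
    · exact hd t s h
    · rw [norm_sub_rev, abs_sub_comm, hd s t h]
  rw [norm_sub_sq_real, hn, hn] at hd'
  rw [fbmCov]
  linarith

/-- The elementary integral of a step function against a curve in a vector space. -/
def StepFun.integralCurve {T : ℝ≥0} (σ : StepFun T) {E : Type*} [AddCommGroup E] [Module ℝ E]
    (f : ℝ≥0 → E) : E :=
  ∑ i, σ.coeff i • (f (σ.right i) - f (σ.left i))

lemma StepFun.isTestFun {T : ℝ≥0} (σ : StepFun T) : IsTestFun T σ.eval :=
  IsTestFun.sum _ fun i _ =>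
    (IsTestFun.indicator_Icc (σ.left i).coe_nonneg (by exact_mod_cast σ.right_le i)).const_mul _

lemma StepFun.fracL2_eval {H : ℝ} (hH : 1 / 2 < H) (hH1 : H < 1) {T : ℝ≥0} (σ : StepFun T) :
    fracL2 H σ.eval = σ.integralCurve (fracInterval H) := by
  have h : σ.eval = fun u => ∑ i, σ.coeff i *
      (Set.Icc (σ.left i : ℝ) (σ.right i : ℝ)).indicator (fun _ => (1 : ℝ)) u := rfl
  rw [h, fracL2_sum (T := T) hH hH1 Finset.univ (fun i _ =>
    IsTestFun.indicator_Icc (σ.left i).coe_nonneg (by exact_mod_cast σ.right_le i)), integralCurve]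
  refine Finset.sum_congr rfl fun i _ => ?_
  rw [fracL2_Icc hH hH1 (σ.left_lt_right i).le]

/-- By bilinearity, curves with proportional covariances have elementary integrals with proportional
inner products; this moves computations from the noise to `fracInterval`. -/
lemma StepFun.inner_integralCurve {S T : ℝ≥0} (σ : StepFun S) (τ : StepFun T)
    {E F : Type*} [NormedAddCommGroup E] [InnerProductSpace ℝ E]
    [NormedAddCommGroup F] [InnerProductSpace ℝ F] {f f' : ℝ≥0 → E} {g g' : ℝ≥0 → F} {γ : ℝ}
    (h : ∀ s t, inner ℝ (f s) (f' t) = γ * inner ℝ (g s) (g' t)) :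
    inner ℝ (σ.integralCurve f) (τ.integralCurve f') =
      γ * inner ℝ (σ.integralCurve g) (τ.integralCurve g') := by
  simp only [integralCurve, sum_inner, inner_sum, real_inner_smul_left, real_inner_smul_right]
  simp only [Finset.mul_sum]
  refine Finset.sum_congr rfl fun i _ => Finset.sum_congr rfl fun j _ => ?_
  simp only [inner_sub_left, inner_sub_right, h]
  ring

lemma tendsto_fracL2_eval {H : ℝ} (hH : 1 / 2 < H) (hH1 : H < 1) {T : ℝ≥0} {φ : ℝ → ℝ}
    (hφ : IsTestFun T φ) {σ : ℕ → StepFun T}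
    (h : Tendsto (fun n => energy H T (fun s => φ s - (σ n).eval s)) atTop (𝓝 0)) :
    Tendsto (fun n => (σ n).integralCurve (fracInterval H)) atTop (𝓝 (fracL2 H φ)) := by
  rw [tendsto_iff_norm_sub_tendsto_zero]
  have h1 : ∀ n, ‖(σ n).integralCurve (fracInterval H) - fracL2 H φ‖ =
      Real.sqrt (fracConst H * energy H T (fun s => φ s - (σ n).eval s)) := by
    intro n
    rw [← norm_sq_fracL2 hH hH1 (hφ.sub (σ n).isTestFun), Real.sqrt_sq (norm_nonneg _),
      fracL2_sub hH hH1 hφ (σ n).isTestFun, ← StepFun.fracL2_eval hH hH1, norm_sub_rev]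
  simp only [h1]
  have h2 := (h.const_mul (fracConst H)).sqrt
  simpa using h2

/-- The isometry property of limits of elementary integrals. -/
lemma inner_eq_of_tendsto_integralCurve {H : ℝ} (hH : 1 / 2 < H) (hH1 : H < 1) {T : ℝ≥0}
    {E : Type*} [NormedAddCommGroup E] [InnerProductSpace ℝ E] {f f' : ℝ≥0 → E} {γ : ℝ}
    (hf : ∀ s t, inner ℝ (f s) (f' t) = γ * fbmCov H s t) {φ φ' : ℝ → ℝ} {V V' : E}
    (hφ : IsTestFun T φ) (hφ' : IsTestFun T φ') {σ σ' : ℕ → StepFun T}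
    (h : Tendsto (fun n => energy H T (fun s => φ s - (σ n).eval s)) atTop (𝓝 0))
    (h' : Tendsto (fun n => energy H T (fun s => φ' s - (σ' n).eval s)) atTop (𝓝 0))
    (hV : Tendsto (fun n => (σ n).integralCurve f) atTop (𝓝 V))
    (hV' : Tendsto (fun n => (σ' n).integralCurve f') atTop (𝓝 V')) :
    inner ℝ V V' =
      γ * (H * (2 * H - 1) / fracConst H) * inner ℝ (fracL2 H φ) (fracL2 H φ') := by
  have hc := (fracConst_pos hH hH1).ne'
  have h1 : H ≠ 0 := by linarith
  have h2 : 2 * H - 1 ≠ 0 := by linarith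
  refine tendsto_nhds_unique (hV.inner hV') ?_
  -- The same step functions are integrated against the curves in `E` and against `fracInterval`.
  -- The inner products are proportional at every stage, hence in the limit, whichever approximating
  -- sequences are used.
  have h3 := ((tendsto_fracL2_eval hH hH1 hφ h).inner
    (tendsto_fracL2_eval hH hH1 hφ' h')).const_mul (γ * (H * (2 * H - 1) / fracConst H))
  refine h3.congr fun n => ?_
  refine ((σ n).inner_integralCurve (σ' n) fun s t => ?_).symm
  rw [hf, inner_fracInterval hH hH1]
  have h4 : H * (2 * H - 1) ≠ 0 := mul_ne_zero h1 h2
  generalize H * (2 * H - 1) = c at h4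
  field_simp

/-! ### A lower bound for the potentials of the heat modes -/

lemma isTestFun_heatKernelMode (l : ℕ) {t T : ℝ≥0} (ht : t ≤ T) :
    IsTestFun T (heatKernelMode l t) := by
  have h : IsTestFun t (heatKernelMode l t) := by
    refine ⟨Measurable.indicator (by fun_prop) measurableSet_Icc, ⟨1, fun u => ?_⟩,
      fun u hu => Set.indicator_of_notMem hu _⟩
    by_cases hu : u ∈ Set.Icc (0 : ℝ) t
    · rw [heatKernelMode, Set.indicator_of_mem hu, abs_of_pos (Real.exp_pos _), Real.exp_le_one_iff]
      have : 0 ≤ (l : ℝ) * (l + 1) * (t - u) := mul_nonneg (by positivity) (by linarith [hu.2])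
      linarith
    · rw [heatKernelMode, Set.indicator_of_notMem hu, abs_zero]
      exact zero_le_one
  exact h.mono (by exact_mod_cast ht)

lemma setIntegral_fracKernel {H : ℝ} (hH : 1 / 2 < H) {z t : ℝ} (hz : z ≤ t) :
    ∫ u in Set.Icc z t, fracKernel H (u - z) = (t - z) ^ (H - 1 / 2) / (H - 1 / 2) := by
  have hs : H - 3 / 2 + 1 = H - 1 / 2 := by ring
  have h := (integral_abs_sub_rpow (s := H - 3 / 2) (by linarith) (Set.left_mem_Icc.2 hz)).2
  rw [hs, sub_self, Real.zero_rpow (by linarith), zero_add] at h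
  rw [← h, integral_Icc_eq_integral_Ioc, integral_Icc_eq_integral_Ioc]
  refine setIntegral_congr_fun measurableSet_Ioc fun u hu => ?_
  rw [fracKernel_of_pos (sub_pos.2 hu.1), abs_sub_comm, abs_of_pos (sub_pos.2 hu.1)]

/-- Only `u ∈ [z,t]` is kept. There `t - u ≤ r`, so the exponential is at least `e^{-ℓ(ℓ+1)r}`, and
`r ≤ t` ensures `[z,t] ⊆ [0,t]`. -/
lemma le_fracPot_heatKernelMode {H : ℝ} (hH : 1 / 2 < H) (l : ℕ) {t : ℝ≥0} {r z : ℝ}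
    (hrt : r ≤ t) (hz : z ∈ Set.Ioo ((t : ℝ) - r) t) :
    Real.exp (-((l : ℝ) * (l + 1)) * r) * ((t - z) ^ (H - 1 / 2) / (H - 1 / 2)) ≤
      fracPot H (heatKernelMode l t) z := by
  rw [← setIntegral_fracKernel hH hz.2.le, ← integral_const_mul, fracPot,
    ← integral_indicator measurableSet_Icc]
  refine integral_mono (IntegrableOn.integrable_indicator
    ((integrableOn_fracKernel hH z t z).const_mul _) measurableSet_Icc) ((isTestFun_heatKernelMode l le_rfl).integrable_mul_fracKernel hH z)
    fun u => ?_
  have hk := fracKernel_nonneg H (u - z)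
  by_cases hu : u ∈ Set.Icc z t
  · rw [Set.indicator_of_mem hu, heatKernelMode,
      Set.indicator_of_mem (Set.mem_Icc.2 ⟨by linarith [hu.1, hz.1], hu.2⟩)]
    refine mul_le_mul_of_nonneg_right (Real.exp_le_exp.2 ?_) hk
    have h1 : (t : ℝ) - u ≤ r := by linarith [hu.1, hz.1]
    have h2 : 0 ≤ (l : ℝ) * (l + 1) := by positivity
    have := mul_le_mul_of_nonneg_left h1 h2
    linarith
  · rw [Set.indicator_of_notMem hu]
    refine mul_nonneg (Set.indicator_nonneg (fun _ _ => (Real.exp_pos _).le) _) hk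

/-- The constant `1 / ((H - 1/2)² 2H)`. -/
def modeConst (H : ℝ) : ℝ := 1 / ((H - 1 / 2) ^ 2 * (2 * H))

lemma modeConst_pos {H : ℝ} (hH : 1 / 2 < H) : 0 < modeConst H := by
  have : 0 < H - 1 / 2 := by linarith
  have : 0 < H := by linarith
  unfold modeConst
  positivity

/-- Strong local nondeterminism of a single mode. -/
lemma le_norm_sq_mode_sub {H : ℝ} (hH : 1 / 2 < H) (hH1 : H < 1) (l : ℕ) {t : ℝ≥0} {r : ℝ}
    (hr : 0 < r) (hrt : r ≤ t) {ι : Type*} (I : Finset ι) (a : ι → ℝ) (s : ι → ℝ≥0)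
    (hs : ∀ i ∈ I, r ≤ (t : ℝ) - s i) :
    modeConst H * Real.exp (-(2 * ((l : ℝ) * (l + 1) * r))) * r ^ (2 * H) ≤
      ‖fracL2 H (heatKernelMode l t) - ∑ i ∈ I, a i • fracL2 H (heatKernelMode l (s i))‖ ^ 2 := by
  have hst : ∀ i ∈ I, s i ≤ t := fun i hi => by
    have := hs i hi
    exact_mod_cast (by linarith : (s i : ℝ) ≤ t)
  have hg := isTestFun_heatKernelMode l (le_refl t)
  have hgs : ∀ i ∈ I, IsTestFun t (heatKernelMode l (s i)) :=
    fun i hi => isTestFun_heatKernelMode l (hst i hi)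
  have hsum := IsTestFun.sum I fun i hi => (hgs i hi).const_mul (a i)
  rw [← fracL2_sum hH hH1 I hgs, ← fracL2_sub hH hH1 hg hsum]
  set φ := fun u => heatKernelMode l t u - ∑ i ∈ I, a i * heatKernelMode l (s i) u with hφdef
  have hφ : IsTestFun t φ := hg.sub hsum
  -- The heart of the nondeterminism: for `z > t - r ≥ s i` the kernel sees only `u > z > s i`,
  -- where every past mode vanishes.
  have hpot : ∀ z ∈ Set.Ioo ((t : ℝ) - r) t, fracPot H φ z = fracPot H (heatKernelMode l t) z := by
    intro z hz
    refine integral_congr_ae (Eventually.of_forall fun u => ?_)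
    simp only
    rcases le_or_gt u z with hu | hu
    · rw [fracKernel_of_nonpos (by linarith), mul_zero, mul_zero]
    · have h0 : ∑ i ∈ I, a i * heatKernelMode l (s i) u = 0 := by
        refine Finset.sum_eq_zero fun i hi => ?_
        have : u ∉ Set.Icc (0 : ℝ) (s i) := fun h => by linarith [h.2, hs i hi, hz.1]
        rw [heatKernelMode, Set.indicator_of_notMem this, mul_zero]
      simp only [hφdef, h0, sub_zero]
  have h2 : ∫ z in Set.Ioo ((t : ℝ) - r) t,
      (Real.exp (-((l : ℝ) * (l + 1)) * r)) ^ 2 / (H - 1 / 2) ^ 2 * |(t : ℝ) - z| ^ (2 * H - 1) =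
      modeConst H * Real.exp (-(2 * ((l : ℝ) * (l + 1) * r))) * r ^ (2 * H) := by
    have hH2 : H - 1 / 2 ≠ 0 := by linarith
    have hH3 : H ≠ 0 := by linarith
    rw [integral_const_mul, ← integral_Icc_eq_integral_Ioo,
      (integral_abs_sub_rpow (s := 2 * H - 1) (by linarith) (Set.right_mem_Icc.2
        (by linarith : (t : ℝ) - r ≤ t))).2, sub_self, Real.zero_rpow (by linarith), ← Real.exp_nat_mul,
      modeConst, show (2 * H - 1 + 1) = 2 * H by ring, show (t : ℝ) - (t - r) = r by ring,
      show ((2 : ℕ) : ℝ) * (-((l : ℝ) * (l + 1)) * r) = -(2 * ((l : ℝ) * (l + 1) * r)) by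
        push_cast; ring]
    field_simp
    ring
  have hsq := (fracPot_mul hH hH1 hφ hφ).1
  rw [← real_inner_self_eq_norm_sq, inner_fracL2 hH hH1 hφ hφ, ← h2]
  -- Outside the window `(t-r,t)` the past may cancel anything, so that part of the squared norm is
  -- discarded.
  refine le_trans ?_ (setIntegral_le_integral (s := Set.Ioo ((t : ℝ) - r) t) hsq
    (Eventually.of_forall fun z => mul_self_nonneg _))
  refine setIntegral_mono_on ?_ hsq.integrableOn measurableSet_Ioo fun z hz => ?_
  · refine IntegrableOn.mono_set ?_ Set.Ioo_subset_Icc_self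
    exact (integral_abs_sub_rpow (s := 2 * H - 1) (by linarith) (Set.right_mem_Icc.2
        (by linarith : (t : ℝ) - r ≤ t))).1.const_mul _
  · have hp := le_fracPot_heatKernelMode hH l hrt hz
    have htz : 0 < (t : ℝ) - z := sub_pos.2 hz.2
    have hpos : 0 ≤ Real.exp (-((l : ℝ) * (l + 1)) * r) * ((t - z) ^ (H - 1 / 2) / (H - 1 / 2)) := by
      have : 0 < H - 1 / 2 := by linarith
      positivity
    rw [hpot z hz, ← sq]
    refine le_trans (le_of_eq ?_) (pow_le_pow_left₀ hpos hp 2)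
    rw [abs_of_pos htz, mul_pow, div_pow, ← Real.rpow_mul_natCast htz.le,
      show (H - 1 / 2) * ((2 : ℕ) : ℝ) = 2 * H - 1 by push_cast; ring]
    ring

/-! ### Centred Gaussian Hilbert spaces -/

section Gaussian

variable {Ω : Type*} [mΩ : MeasurableSpace Ω] {P : Measure Ω}

/-- An element of `L²(P)` that is a centred Gaussian random variable. -/
def IsCenteredGaussian (X : Lp ℝ 2 P) : Prop := HasGaussianLaw X P ∧ ∫ ω, X ω ∂P = 0

/-- A linear subspace of `L²(P)` that consists of centred Gaussian variables. -/
def IsGaussianSpace (V : Submodule ℝ (Lp ℝ 2 P)) : Prop := ∀ X ∈ V, IsCenteredGaussian X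

lemma integral_mul_eq_inner (X Y : Lp ℝ 2 P) : ∫ ω, X ω * Y ω ∂P = inner ℝ X Y := by
  rw [L2.inner_def]
  simp [mul_comm]

lemma inner_toLp {f g : Ω → ℝ} (hf : MemLp f 2 P) (hg : MemLp g 2 P) :
    inner ℝ (hf.toLp f) (hg.toLp g) = ∫ ω, f ω * g ω ∂P := by
  rw [← integral_mul_eq_inner]
  refine integral_congr_ae ?_
  filter_upwards [hf.coeFn_toLp, hg.coeFn_toLp] with ω h1 h2
  rw [h1, h2]

lemma coeFn_sum_smul {ι : Type*} (I : Finset ι) (a : ι → ℝ) (X : ι → Lp ℝ 2 P) :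
    (∑ i ∈ I, a i • X i : Lp ℝ 2 P) =ᵐ[P] fun ω => ∑ i ∈ I, a i * X i ω := by
  classical
  induction I using Finset.induction_on with
  | empty =>
    simp only [Finset.sum_empty]
    exact Lp.coeFn_zero ℝ 2 P
  | insert i I hi ih =>
    simp only [Finset.sum_insert hi]
    filter_upwards [ih, Lp.coeFn_add (a i • X i) (∑ j ∈ I, a j • X j),
      Lp.coeFn_smul (a i) (X i)] with ω h1 h2 h3
    rw [h2, Pi.add_apply, h1, h3, Pi.smul_apply, smul_eq_mul]

/-- A linear functional of finitely many elements of `V` is almost surely another element of `V`,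
hence Gaussian; this is joint Gaussianity. -/
lemma IsGaussianSpace.isGaussianProcess {V : Submodule ℝ (Lp ℝ 2 P)} (hV : IsGaussianSpace V) :
    IsGaussianProcess (fun (X : V) (ω : Ω) => (X : Lp ℝ 2 P) ω) P := by
  classical
  refine ⟨fun I => ⟨isGaussian_of_isGaussian_map fun L => ?_⟩⟩
  have hm : ∀ X : V, AEMeasurable (X : Lp ℝ 2 P) P :=
    fun X => (Lp.aestronglyMeasurable _).aemeasurable
  have hmv : AEMeasurable (fun ω => I.restrict fun X : V => (X : Lp ℝ 2 P) ω) P :=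
    aemeasurable_pi_lambda _ fun X => hm X
  rw [AEMeasurable.map_map_of_aemeasurable (by fun_prop) hmv]
  set Y : Lp ℝ 2 P := ∑ i : I, L (Pi.single i 1) • ((i : V) : Lp ℝ 2 P) with hY
  have hYV : Y ∈ V := V.sum_mem fun i _ => V.smul_mem _ (i : V).2
  have hae : (⇑L ∘ fun ω => I.restrict fun X : V => (X : Lp ℝ 2 P) ω) =ᵐ[P] Y := by
    filter_upwards [coeFn_sum_smul Finset.univ (fun i : I => L (Pi.single i 1))
      (fun i : I => ((i : V) : Lp ℝ 2 P))] with ω hω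
    rw [hY, hω, Function.comp_apply]
    conv_lhs => rw [← Finset.univ_sum_single (I.restrict fun X : V => (X : Lp ℝ 2 P) ω)]
    rw [map_sum]
    refine Finset.sum_congr rfl fun i _ => ?_
    have : (Pi.single i (I.restrict (fun X : V => (X : Lp ℝ 2 P) ω) i) : I → ℝ) =
        (((i : V) : Lp ℝ 2 P) ω) • (Pi.single i (1 : ℝ) : I → ℝ) := by
      rw [← Pi.single_smul]; simp
    rw [this, map_smul, smul_eq_mul, mul_comm]
  rw [Measure.map_congr hae]
  exact (hV Y hYV).1.isGaussian_map

variable [IsProbabilityMeasure P]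

lemma integral_eq_inner_one (X : Lp ℝ 2 P) :
    ∫ ω, X ω ∂P = inner ℝ ((memLp_const (1 : ℝ)).toLp (fun _ : Ω => (1 : ℝ))) X := by
  rw [← integral_mul_eq_inner]
  refine integral_congr_ae ?_
  filter_upwards [(memLp_const (μ := P) (p := 2) (1 : ℝ)).coeFn_toLp] with ω h1
  rw [h1, one_mul]

lemma covariance_eq_inner {X Y : Lp ℝ 2 P} (hX : ∫ ω, X ω ∂P = 0) :
    cov[X, Y; P] = inner ℝ X Y := by
  rw [covariance_eq_sub (Lp.memLp X) (Lp.memLp Y), hX, zero_mul, sub_zero]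
  exact integral_mul_eq_inner X Y

/-- The characteristic function form, in which the only parameter is `‖X‖`; every expression in it
passes to `L²` limits. -/
lemma isCenteredGaussian_iff (X : Lp ℝ 2 P) : IsCenteredGaussian X ↔
    ∫ ω, X ω ∂P = 0 ∧
      ∀ t : ℝ, ∫ ω, Complex.exp (t * X ω * Complex.I) ∂P = Complex.exp (-(t ^ 2 * ‖X‖ ^ 2 / 2)) := by
  have hm : AEMeasurable X P := (Lp.aestronglyMeasurable X).aemeasurable
  rw [IsCenteredGaussian, and_comm]
  refine and_congr_right fun h0 => ?_
  rw [hasGaussianLaw_iff_charFun_map_eq hm]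
  refine forall_congr' fun t => ?_
  have h1 : charFun (P.map X) t = ∫ ω, Complex.exp (t * X ω * Complex.I) ∂P := by
    rw [charFun_apply_real, integral_map hm (by fun_prop)]
  have h2 : ∫ ω, inner ℝ t (X ω) ∂P = 0 := by
    have : ∀ ω, inner ℝ t (X ω) = t * X ω := fun ω => by simp [mul_comm]
    simp only [this]
    rw [integral_const_mul, h0, mul_zero]
  have h3 : Var[fun ω => inner ℝ t (X ω); P] = t ^ 2 * ‖X‖ ^ 2 := by
    have : (fun ω => inner ℝ t (X ω)) = fun ω => t * X ω := by
      funext ω; simp [mul_comm]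
    rw [this, variance_const_mul, ← covariance_self hm, covariance_eq_inner h0,
      real_inner_self_eq_norm_sq]
  rw [h1, h2, h3]
  push_cast
  rw [zero_mul, zero_sub]

lemma isClosed_isCenteredGaussian : IsClosed {X : Lp ℝ 2 P | IsCenteredGaussian X} := by
  refine IsSeqClosed.isClosed fun X Y hX hXY => ?_
  have hX' := fun n => (isCenteredGaussian_iff (X n)).1 (hX n)
  refine (isCenteredGaussian_iff Y).2 ⟨?_, fun t => ?_⟩
  · have h1 := (tendsto_const_nhds (x := (memLp_const (1 : ℝ)).toLp (fun _ : Ω => (1 : ℝ)))).inner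
      (𝕜 := ℝ) hXY
    simp only [← integral_eq_inner_one, (hX' _).1] at h1
    exact (tendsto_nhds_unique tendsto_const_nhds h1).symm
  -- An almost surely convergent subsequence suffices: the exponentials have modulus one, so
  -- dominated convergence applies.
  · obtain ⟨ns, hns, hae⟩ := (tendstoInMeasure_of_tendsto_Lp hXY).exists_seq_tendsto_ae
    have h1 : Tendsto (fun n => ∫ ω, Complex.exp (t * X (ns n) ω * Complex.I) ∂P) atTop
        (𝓝 (∫ ω, Complex.exp (t * Y ω * Complex.I) ∂P)) := by
      refine tendsto_integral_of_dominated_convergence (fun _ => 1) (fun n => ?_)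
        (integrable_const _) (fun n => Eventually.of_forall fun ω => ?_) ?_
      · have hm : AEMeasurable (X (ns n)) P := (Lp.aestronglyMeasurable _).aemeasurable
        exact AEMeasurable.aestronglyMeasurable (by fun_prop)
      · rw [← Complex.ofReal_mul, Complex.norm_exp_ofReal_mul_I]
      · filter_upwards [hae] with ω hω
        have hc : Continuous fun y : ℝ => Complex.exp (t * y * Complex.I) := by fun_prop
        exact (hc.tendsto _).comp hω
    have h2 : Tendsto (fun n => Complex.exp (-(t ^ 2 * ‖X (ns n)‖ ^ 2 / 2))) atTop
        (𝓝 (Complex.exp (-(t ^ 2 * ‖Y‖ ^ 2 / 2)))) := by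
      have hc : Continuous fun y : ℝ => Complex.exp (-(t ^ 2 * y ^ 2 / 2)) := by fun_prop
      exact (hc.tendsto _).comp (hXY.norm.comp hns.tendsto_atTop)
    refine tendsto_nhds_unique h1 (h2.congr fun n => ((hX' (ns n)).2 t).symm)

lemma IsGaussianSpace.topologicalClosure {V : Submodule ℝ (Lp ℝ 2 P)} (hV : IsGaussianSpace V) :
    IsGaussianSpace V.topologicalClosure :=
  fun _ hX => closure_minimal (fun Y hY => hV Y hY) isClosed_isCenteredGaussian hX

/-- In a Gaussian space, orthogonality to a subspace implies independence. -/
lemma IsGaussianSpace.indepFun_of_orthogonal {V M : Submodule ℝ (Lp ℝ 2 P)}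
    (hV : IsGaussianSpace V) (hM : M ≤ V) {D : Lp ℝ 2 P} (hD : D ∈ V)
    (hDM : ∀ X ∈ M, inner ℝ D X = 0) :
    IndepFun (D : Ω → ℝ) (fun ω (X : M) => (X : Lp ℝ 2 P) ω) P := by
  have hproc := hV.isGaussianProcess
  have h1 : IsGaussianProcess (Sum.elim (fun (_ : Unit) ω => D ω)
      (fun (X : M) ω => (X : Lp ℝ 2 P) ω)) P := by
    have h := hproc.comp_right (Sum.elim (fun _ : Unit => (⟨D, hD⟩ : V))
      (fun X : M => (⟨X, hM X.2⟩ : V)))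
    have e : (Sum.elim (fun (_ : Unit) ω => D ω) (fun (X : M) ω => (X : Lp ℝ 2 P) ω)) =
        (fun (X : V) (ω : Ω) => (X : Lp ℝ 2 P) ω) ∘ (Sum.elim (fun _ : Unit => (⟨D, hD⟩ : V))
          (fun X : M => (⟨X, hM X.2⟩ : V))) := by
      funext i
      rcases i with i | i <;> rfl
    rw [e]
    exact h
  have hm : ∀ X : Lp ℝ 2 P, AEMeasurable X P := fun X => (Lp.aestronglyMeasurable _).aemeasurable
  have h2 := h1.indepFun_of_covariance_eq_zero (fun _ => hm D) (fun X => hm X) fun _ X => by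
    have := covariance_eq_inner (Y := (X : Lp ℝ 2 P)) (hV D hD).2
    exact this.trans (hDM X X.2)
  exact h2.comp (φ := fun f : Unit → ℝ => f ()) (ψ := id) (measurable_pi_apply _) measurable_id

end Gaussian

/-! ### Independence and conditional variance -/

section Independence

variable {Ω : Type*} [mΩ : MeasurableSpace Ω] {P : Measure Ω}

/-- Adding null sets changes no probability. Completion is needed because elements of `L²` are
measurable with respect to sub-σ-algebras only up to null sets. -/
lemma Indep.eventuallyMeasurableSpace_right {m₁ m₂ : MeasurableSpace Ω} (h : Indep m₁ m₂ P) :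
    Indep m₁ (eventuallyMeasurableSpace m₂ (ae P)) P := by
  rw [Indep_iff] at h ⊢
  rintro s t hs ⟨t', ht', htt'⟩
  rw [measure_congr (ae_eq_set_inter (EventuallyEq.refl _ s) htt'), measure_congr htt', h s t' hs ht']

variable [IsProbabilityMeasure P]

/-- If `m₁` is independent of `m₂` and `m₁ ⊔ m₂` is independent of `m₀`, then `m₁` is independent
of `m₀ ⊔ m₂`. -/
lemma indep_sup_of_indep {m₀ m₁ m₂ : MeasurableSpace Ω} (h₀ : m₀ ≤ mΩ) (h₁ : m₁ ≤ mΩ) (h₂ : m₂ ≤ mΩ)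
    (h12 : Indep m₁ m₂ P) (h : Indep m₀ (m₁ ⊔ m₂) P) : Indep m₁ (m₀ ⊔ m₂) P := by
  have hgen : m₀ ⊔ m₂ = MeasurableSpace.generateFrom
      (Set.image2 (· ∩ ·) {s | MeasurableSet[m₀] s} {s | MeasurableSet[m₂] s}) := by
    refine le_antisymm (sup_le ?_ ?_) (MeasurableSpace.generateFrom_le ?_)
    · intro s hs
      exact MeasurableSpace.measurableSet_generateFrom
        ⟨s, hs, Set.univ, MeasurableSet.univ, Set.inter_univ s⟩
    · intro s hs
      exact MeasurableSpace.measurableSet_generateFrom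
        ⟨Set.univ, MeasurableSet.univ, s, hs, Set.univ_inter s⟩
    · rintro _ ⟨s, hs, t, ht, rfl⟩
      exact MeasurableSet.inter (le_sup_left (a := m₀) s hs) (le_sup_right (a := m₀) t ht)
  have hpi : IsPiSystem
      (Set.image2 (· ∩ ·) {s | MeasurableSet[m₀] s} {s | MeasurableSet[m₂] s}) := by
    rintro _ ⟨s, hs, t, ht, rfl⟩ _ ⟨s', hs', t', ht', rfl⟩ -
    refine ⟨s ∩ s', MeasurableSet.inter hs hs', t ∩ t', MeasurableSet.inter ht ht', ?_⟩
    simp only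
    ac_rfl
  refine IndepSets.indep h₁ (sup_le h₀ h₂) (@MeasurableSpace.isPiSystem_measurableSet Ω m₁) hpi
    (@MeasurableSpace.generateFrom_measurableSet Ω m₁).symm hgen ?_
  rw [IndepSets_iff]
  rintro a _ ha ⟨s, hs, t, ht, rfl⟩
  rw [Indep_iff] at h12 h
  have ha' : MeasurableSet[m₁ ⊔ m₂] a := le_sup_left (a := m₁) a ha
  have ht' : MeasurableSet[m₁ ⊔ m₂] t := le_sup_right (a := m₁) t ht
  simp only
  -- Regroup so that `m₀` is split off first from `m₁ ⊔ m₂`, then `m₁` from `m₂`; intersections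
  -- suffice because they form a generating π-system.
  rw [show a ∩ (s ∩ t) = s ∩ (a ∩ t) by ac_rfl, h s _ hs (MeasurableSet.inter ha' ht'),
    h12 a t ha ht, h s t hs ht']
  ring

end Independence

/-- If `X = D + R` with `D` centred and independent of a σ-algebra that contains `G` and makes `R`
measurable, then `Var(X | G) ≥ Var D`. -/
theorem le_condVar_of_indep {Ω : Type*} {G 𝓔 : MeasurableSpace Ω} [mΩ : MeasurableSpace Ω]
    {P : Measure Ω} [IsProbabilityMeasure P] {X D : Ω → ℝ} (hG : G ≤ mΩ) (hG𝓔 : G ≤ 𝓔)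
    (hX : Measurable X) (hX2 : MemLp X 2 P) (hD : Measurable D) (hD2 : MemLp D 2 P)
    (hD0 : ∫ ω, D ω ∂P = 0) (hind : Indep (MeasurableSpace.comap D inferInstance) 𝓔 P)
    (hR : Measurable[𝓔] fun ω => X ω - D ω) :
    ∀ᵐ ω ∂P, ∫ ω, D ω ^ 2 ∂P ≤ (Var[X; P | G]) ω := by
  -- The conditional residual is `X - E[X|G] = D + S` with `S` measurable for `𝓔`. In its square,
  -- `D²` contributes `Var D`, the cross term has zero conditional mean, and `S²` is nonnegative.
  set S : Ω → ℝ := fun ω => X ω - D ω - (P[X | G]) ω with hS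
  have hcG : Measurable[G] (P[X | G]) := stronglyMeasurable_condExp.measurable
  have hSm : Measurable S := (hX.sub hD).sub (hcG.mono hG le_rfl)
  have hS𝓔 : Measurable[𝓔] S := hR.sub (hcG.mono hG𝓔 le_rfl)
  have hS2 : MemLp S 2 P := (hX2.sub hD2).sub (hX2.condExp one_le_two)
  have hG'm : MeasurableSpace.comap S inferInstance ⊔ G ≤ mΩ := sup_le hSm.comap_le hG
  have hG'𝓔 : MeasurableSpace.comap S inferInstance ⊔ G ≤ 𝓔 := sup_le hS𝓔.comap_le hG𝓔
  have hDm : MeasurableSpace.comap D inferInstance ≤ mΩ := hD.comap_le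
  have hDs : Measurable[MeasurableSpace.comap D inferInstance] D := comap_measurable D
  have e1 : P[fun ω => D ω ^ 2 | G] =ᵐ[P] fun _ => ∫ ω, D ω ^ 2 ∂P :=
    condExp_indep_eq hDm hG (hDs.pow_const 2).stronglyMeasurable
      (indep_of_indep_of_le_right hind hG𝓔)
  have e2 : P[D | MeasurableSpace.comap S inferInstance ⊔ G] =ᵐ[P] fun _ => 0 := by
    have := condExp_indep_eq hDm hG'm hDs.stronglyMeasurable
      (indep_of_indep_of_le_right hind hG'𝓔)
    rwa [hD0] at this
  have hSD : Integrable (S * D) P := hS2.integrable_mul hD2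
  have hSG' : StronglyMeasurable[MeasurableSpace.comap S inferInstance ⊔ G] S :=
    ((comap_measurable S).mono (le_sup_left (b := G)) le_rfl).stronglyMeasurable
  -- `S` is not `G`-measurable, so condition first on `σ(S) ⊔ G`: this still lies in `𝓔`, so there
  -- `S` factors out and `D` averages to zero.
  have e3 : P[S * D | G] =ᵐ[P] 0 := by
    have h1 : P[S * D | MeasurableSpace.comap S inferInstance ⊔ G] =ᵐ[P] 0 := by
      refine (condExp_mul_of_stronglyMeasurable_left hSG' hSD (hD2.integrable one_le_two)).trans ?_
      filter_upwards [e2] with ω hω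
      rw [Pi.mul_apply, hω, mul_zero, Pi.zero_apply]
    have h2 := condExp_condExp_of_le (μ := P) (f := S * D) 
      (le_sup_right (a := MeasurableSpace.comap S inferInstance)) hG'm
    refine h2.symm.trans ((condExp_congr_ae h1).trans ?_)
    rw [condExp_zero]
  have e4 : 0 ≤ᵐ[P] P[fun ω => S ω ^ 2 | G] :=
    condExp_nonneg (Eventually.of_forall fun ω => sq_nonneg (S ω))
  have hdec : (X - P[X | G]) ^ 2 = (fun ω => D ω ^ 2) + ((2 : ℝ) • (S * D) + fun ω => S ω ^ 2) := by
    funext ω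
    simp only [hS, Pi.add_apply, Pi.pow_apply, Pi.sub_apply, Pi.smul_apply, Pi.mul_apply,
      smul_eq_mul]
    ring
  have i1 : Integrable (fun ω => D ω ^ 2) P := hD2.integrable_sq
  have i2 : Integrable (fun ω => S ω ^ 2) P := hS2.integrable_sq
  have i3 : Integrable ((2 : ℝ) • (S * D)) P := hSD.smul 2
  rw [condVar, hdec]
  filter_upwards [e1, e3, e4, condExp_add i1 (i3.add i2) G, condExp_add i3 i2 G,
    condExp_smul (μ := P) (2 : ℝ) (S * D) G] with ω h1 h3 h4 h5 h6 h7
  rw [h5, Pi.add_apply, h6, Pi.add_apply, h7, Pi.smul_apply, h3, h1]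
  simp only [Pi.zero_apply, smul_zero, zero_add] at h4 ⊢
  linarith

/-! ### The Gaussian space of the noise -/

/-- A closed subspace of `L²(P)` generated by `m`-measurable variables consists of such. -/
lemma aestronglyMeasurable_of_mem_closure_span {Ω : Type*} {m : MeasurableSpace Ω}
    [mΩ : MeasurableSpace Ω] {P : Measure Ω} (hm : m ≤ mΩ)
    {S : Set (Lp ℝ 2 P)} (hS : ∀ X ∈ S, AEStronglyMeasurable[m] X P) {X : Lp ℝ 2 P}
    (hX : X ∈ (Submodule.span ℝ S).topologicalClosure) : AEStronglyMeasurable[m] X P := by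
  have h1 : Submodule.span ℝ S ≤ lpMeas ℝ ℝ m 2 P :=
    Submodule.span_le.2 fun X hX => mem_lpMeas_iff_aestronglyMeasurable.2 (hS X hX)
  exact closure_minimal (s := (Submodule.span ℝ S : Set (Lp ℝ 2 P)))
    (t := {Y : Lp ℝ 2 P | AEStronglyMeasurable[m] Y P}) (fun Y hY => mem_lpMeas_iff_aestronglyMeasurable.1 (h1 hY))
    (isClosed_aestronglyMeasurable (F := ℝ) (p := 2) (μ := P) hm) hX

section Noise

variable {Ω : Type*} [mΩ : MeasurableSpace Ω] {P : Measure Ω}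

/-- The class of `f` in `L²(P)` (zero if `f` is not square integrable). -/
def toL2 (P : Measure Ω) (f : Ω → ℝ) : Lp ℝ 2 P :=
  open Classical in if h : MemLp f 2 P then h.toLp f else 0

lemma toL2_eq {f : Ω → ℝ} (h : MemLp f 2 P) : toL2 P f = h.toLp f := dif_pos h

lemma coeFn_toL2 {f : Ω → ℝ} (h : MemLp f 2 P) : toL2 P f =ᵐ[P] f := by
  rw [toL2_eq h]
  exact h.coeFn_toLp

lemma toL2_ext {f : Ω → ℝ} (h : MemLp f 2 P) {X : Lp ℝ 2 P} (hX : X =ᵐ[P] f) : toL2 P f = X :=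
  Lp.ext ((coeFn_toL2 h).trans hX.symm)

lemma inner_toL2 {f g : Ω → ℝ} (hf : MemLp f 2 P) (hg : MemLp g 2 P) :
    inner ℝ (toL2 P f) (toL2 P g) = ∫ ω, f ω * g ω ∂P := by
  rw [toL2_eq hf, toL2_eq hg, inner_toLp]

lemma toL2_sum_mul {ι : Type*} (I : Finset ι) (a : ι → ℝ) {f : ι → Ω → ℝ}
    (hf : ∀ i ∈ I, MemLp (f i) 2 P) :
    toL2 P (fun ω => ∑ i ∈ I, a i * f i ω) = ∑ i ∈ I, a i • toL2 P (f i) := by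
  have hm : MemLp (fun ω => ∑ i ∈ I, a i * f i ω) 2 P :=
    memLp_finsetSum I fun i hi => (hf i hi).const_mul (a i)
  refine toL2_ext hm ((coeFn_sum_smul I a _).trans ?_)
  have h : ∀ᵐ ω ∂P, ∀ i ∈ I, toL2 P (f i) ω = f i ω := by
    rw [Filter.eventually_all_finset]
    exact fun i hi => coeFn_toL2 (hf i hi)
  filter_upwards [h] with ω hω
  exact Finset.sum_congr rfl fun i hi => by rw [hω i hi]

variable {H : ℝ} {β : ℕ → ℤ → ℝ≥0 → Ω → ℂ}

lemma IsFBM.memLp {B : ℝ≥0 → Ω → ℝ} (hB : IsFBM P H B) (t : ℝ≥0) : MemLp (B t) 2 P :=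
  (hB.gaussian.hasGaussianLaw_eval t).memLp_two

/-- The real process that carries `β`, at the index `p` and the time `t`, in `L²(P)`. -/
def noiseVar (P : Measure Ω) (β : ℕ → ℤ → ℝ≥0 → Ω → ℂ) (p : HarmIdx) (t : ℝ≥0) : Lp ℝ 2 P :=
  toL2 P (realComponent β p.1.1 p.1.2 t)

/-- The closed linear span of the noise. -/
def noiseSpace (P : Measure Ω) (β : ℕ → ℤ → ℝ≥0 → Ω → ℂ) : Submodule ℝ (Lp ℝ 2 P) :=
  (Submodule.span ℝ (Set.range fun q : HarmIdx × ℝ≥0 => noiseVar P β q.1 q.2)).topologicalClosure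

lemma noiseVar_mem (p : HarmIdx) (t : ℝ≥0) : noiseVar P β p t ∈ noiseSpace P β :=
  Submodule.le_topologicalClosure _ (Submodule.subset_span ⟨(p, t), rfl⟩)

lemma inner_noiseVar (hβ : IsNoiseFamily P H β) (p q : HarmIdx) (s t : ℝ≥0) :
    inner ℝ (noiseVar P β p s) (noiseVar P β q t) = if p = q then fbmCov H s t else 0 := by
  have hp := hβ.fbm p.1.1 p.1.2 p.2
  have hq := hβ.fbm q.1.1 q.1.2 q.2
  rw [noiseVar, noiseVar, inner_toL2 (hp.memLp s) (hq.memLp t)]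
  split_ifs with h
  · subst h
    exact hp.covariance s t
  · have hi := (hβ.indep.indepFun h).comp (φ := fun f : ℝ≥0 → ℝ => f s)
      (ψ := fun f : ℝ≥0 → ℝ => f t)
      (measurable_pi_apply (X := fun _ => ℝ) s) (measurable_pi_apply (X := fun _ => ℝ) t)
    have h2 := hi.integral_mul_eq_mul_integral (hp.memLp s).1 (hq.memLp t).1
    have h3 := hp.centered s
    refine h2.trans ?_
    change (∫ ω, realComponent β p.1.1 p.1.2 s ω ∂P) * _ = 0
    rw [h3, zero_mul]

/-- Independent Gaussian vectors are jointly Gaussian. A finite set of pairs (index, time) is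
enlarged to the rectangle of its projections, to which independence over the indices applies, and
then restricted by a linear map. -/
lemma isGaussianProcess_realComponent (hβ : IsNoiseFamily P H β) :
    IsGaussianProcess (fun (q : HarmIdx × ℝ≥0) => realComponent β q.1.1.1 q.1.1.2 q.2) P := by
  classical
  refine ⟨fun I => ?_⟩
  set I₁ := I.image Prod.fst with hI₁
  set I₂ := I.image Prod.snd with hI₂
  have h1 : HasGaussianLaw (fun ω (p : I₁) (s : I₂) =>
      realComponent β p.1.1.1 p.1.1.2 s ω) P := by
    refine iIndepFun.hasGaussianLaw (X := fun (p : I₁) ω (s : I₂) =>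
      realComponent β p.1.1.1 p.1.1.2 s ω) (fun p => ?_) ?_
    · exact (hβ.fbm p.1.1.1 p.1.1.2 p.1.2).gaussian.hasGaussianLaw I₂
    · have h2 := (hβ.indep.precomp (g := fun p : I₁ => p.1) Subtype.val_injective).comp
        (fun _ (f : ℝ≥0 → ℝ) (s : I₂) => f s)
        (fun _ => measurable_pi_lambda _ fun s => measurable_pi_apply _)
      exact h2
  let L : (I₁ → I₂ → ℝ) →L[ℝ] (I → ℝ) :=
    { toFun x q := x ⟨q.1.1, Finset.mem_image_of_mem _ q.2⟩ ⟨q.1.2, Finset.mem_image_of_mem _ q.2⟩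
      map_add' x y := by ext; simp
      map_smul' c x := by ext; simp }
  exact h1.map L

lemma isGaussianSpace_noiseSpace [IsProbabilityMeasure P] (hβ : IsNoiseFamily P H β) :
    IsGaussianSpace (noiseSpace P β) := by
  refine IsGaussianSpace.topologicalClosure fun X hX => ?_
  obtain ⟨c, rfl⟩ := (Finsupp.mem_span_range_iff_exists_finsupp).1 hX
  have hL := fun q : HarmIdx × ℝ≥0 => (hβ.fbm q.1.1.1 q.1.1.2 q.1.2).memLp q.2
  have hae : (c.sum fun q a => a • noiseVar P β q.1 q.2 : Lp ℝ 2 P) =ᵐ[P]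
      fun ω => ∑ q ∈ c.support, c q * realComponent β q.1.1.1 q.1.1.2 q.2 ω := by
    have h := toL2_sum_mul c.support c (f := fun q => realComponent β q.1.1.1 q.1.1.2 q.2)
      fun q _ => hL q
    have h2 : (c.sum fun q a => a • noiseVar P β q.1 q.2 : Lp ℝ 2 P) =
        ∑ q ∈ c.support, c q • noiseVar P β q.1 q.2 := rfl
    rw [h2]
    simp only [noiseVar]
    rw [← h]
    exact coeFn_toL2 (memLp_finsetSum _ fun q _ => (hL q).const_mul (c q))
  have hG := ((isGaussianProcess_realComponent hβ).smul (fun q => c q)).hasGaussianLaw_fun_sum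
    (I := c.support)
  refine ⟨hG.congr hae.symm, ?_⟩
  rw [integral_congr_ae hae, integral_finsetSum _ fun q _ =>
    ((hL q).integrable one_le_two).const_mul (c q)]
  refine Finset.sum_eq_zero fun q _ => ?_
  rw [integral_const_mul, (hβ.fbm q.1.1.1 q.1.1.2 q.1.2).centered, mul_zero]

/-- The σ-algebra generated by the noise. -/
abbrev noiseSigma (β : ℕ → ℤ → ℝ≥0 → Ω → ℂ) : MeasurableSpace Ω :=
  MeasurableSpace.comap (fun (ω : Ω) (q : HarmIdx × ℝ≥0) => β q.1.1.1 q.1.1.2 q.2 ω) inferInstance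

lemma noiseSigma_le (hβ : IsNoiseFamily P H β) : noiseSigma β ≤ mΩ :=
  Measurable.comap_le (measurable_pi_lambda _ fun q => hβ.measurable _ _ q.1.2 _)

lemma measurable_realComponent {Ω : Type*} {β : ℕ → ℤ → ℝ≥0 → Ω → ℂ} (p : HarmIdx) (t : ℝ≥0) :
    Measurable[noiseSigma β] (realComponent β p.1.1 p.1.2 t) := by
  have h : ∀ q : HarmIdx, Measurable[noiseSigma β] (β q.1.1 q.1.2 t) := fun q =>
    (measurable_pi_apply (X := fun _ : HarmIdx × ℝ≥0 => ℂ) (q, t)).comp (comap_measurable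
      (fun (ω : Ω) (q : HarmIdx × ℝ≥0) => β q.1.1.1 q.1.1.2 q.2 ω))
  have h0 := h ⟨(p.1.1, 0), by simp⟩
  have h1 := h p
  have h2 := h ⟨(p.1.1, -p.1.2), by simpa using p.2⟩
  unfold realComponent
  split_ifs
  · exact Complex.measurable_re.comp h0
  · exact (Complex.measurable_re.comp h1).const_mul _
  · exact (Complex.measurable_im.comp h2).const_mul _

lemma aestronglyMeasurable_of_mem_noiseSpace (hβ : IsNoiseFamily P H β) {X : Lp ℝ 2 P}
    (hX : X ∈ noiseSpace P β) : AEStronglyMeasurable[noiseSigma β] X P := by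
  refine aestronglyMeasurable_of_mem_closure_span (noiseSigma_le hβ) ?_ hX
  rintro _ ⟨q, rfl⟩
  exact ⟨_, (measurable_realComponent q.1 q.2).stronglyMeasurable,
    coeFn_toL2 ((hβ.fbm _ _ q.1.2).memLp q.2)⟩

end Noise

/-! ### The coefficients of the initial field -/

section InitialField

variable {Ω : Type*} [mΩ : MeasurableSpace Ω] {P : Measure Ω} [IsProbabilityMeasure P]

lemma continuous_sphHarm (l : ℕ) (m : ℤ) : Continuous (sphHarm l m) := by
  have h : ∀ n, Continuous (sphHarmNonneg l n) := fun n => by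
    unfold sphHarmNonneg
    fun_prop
  unfold sphHarm
  split_ifs
  · exact h _
  · have := h m.natAbs
    fun_prop

instance : IsFiniteMeasure surfaceMeasure := by unfold surfaceMeasure; infer_instance

lemma sq_integral_le {α : Type*} [MeasurableSpace α] {ν : Measure α} [IsFiniteMeasure ν] {f : α → ℝ}
    (hf : MemLp f 2 ν) : (∫ x, f x ∂ν) ^ 2 ≤ ν.real Set.univ * ∫ x, f x ^ 2 ∂ν := by
  have h1 : MemLp (fun _ : α => (1 : ℝ)) 2 ν := memLp_const 1
  have h := real_inner_mul_inner_self_le (h1.toLp _) (hf.toLp f)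
  rw [inner_toLp, inner_toLp, inner_toLp] at h
  simpa [sq] using h

/-- Integrals over `x` of a square integrable field against a bounded function are square integrable
and measurable with respect to the field, up to null sets. -/
lemma integral_field_mul {Ω : Type*} {m : MeasurableSpace Ω} [mΩ : MeasurableSpace Ω]
    {P : Measure Ω} [IsProbabilityMeasure P] {α : Type*} [MeasurableSpace α] {ν : Measure α}
    [IsFiniteMeasure ν] (hm : m ≤ mΩ) {v : α → Ω → ℝ} (hv : ∀ x, Measurable[m] (v x))
    (hv2 : MemLp (fun p : Ω × α => v p.2 p.1) 2 (P.prod ν)) {g : α → ℝ} (hg : Measurable g)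
    {c : ℝ} (hgc : ∀ x, |g x| ≤ c) :
    MemLp (fun ω => ∫ x, v x ω * g x ∂ν) 2 P ∧
      AEStronglyMeasurable[m] (fun ω => ∫ x, v x ω * g x ∂ν) P := by
  have hG : MemLp (fun p : Ω × α => v p.2 p.1 * g p.2) 2 (P.prod ν) := by
    refine MemLp.of_le_mul (c := c) hv2 (hv2.1.mul (hg.comp measurable_snd).aestronglyMeasurable)
      (Eventually.of_forall fun p => ?_)
    rw [norm_mul, mul_comm]
    exact mul_le_mul_of_nonneg_right (hgc _) (norm_nonneg _)
  have hVm : AEStronglyMeasurable (fun ω => ∫ x, v x ω * g x ∂ν) P :=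
    hG.1.integral_prod_right'
  have hV : MemLp (fun ω => ∫ x, v x ω * g x ∂ν) 2 P := by
    rw [memLp_two_iff_integrable_sq hVm]
    refine Integrable.mono' ((hG.integrable_sq.integral_prod_left).const_mul (ν.real Set.univ))
      (hVm.pow 2) ?_
    filter_upwards [hG.integrable_sq.prod_right_ae, hG.1.prodMk_left] with ω h1 h2
    rw [Real.norm_of_nonneg (sq_nonneg _)]
    exact sq_integral_le ((memLp_two_iff_integrable_sq h2).2 h1)
  refine ⟨hV, ?_⟩
  have : Fact (m ≤ mΩ) := ⟨hm⟩
  suffices h : toL2 P (fun ω => ∫ x, v x ω * g x ∂ν) ∈ lpMeas ℝ ℝ m 2 P by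
    exact (mem_lpMeas_iff_aestronglyMeasurable.1 h).congr (coeFn_toL2 hV)
  -- The field is only known to be jointly measurable for the full σ-algebra, so `m`-measurability
  -- of the integral is shown by duality: if `W` is orthogonal to all `m`-measurable variables, then
  -- by Fubini it is orthogonal to the integral, because it is orthogonal to almost every `v x`.
  rw [← Submodule.orthogonal_orthogonal (lpMeas ℝ ℝ m 2 P), Submodule.mem_orthogonal]
  intro W hW
  have hW2 : MemLp (fun p : Ω × α => W p.1) 2 (P.prod ν) := (Lp.memLp W).comp_fst ν
  have hWG : Integrable (fun p : Ω × α => W p.1 * (v p.2 p.1 * g p.2)) (P.prod ν) :=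
    hW2.integrable_mul hG
  have e1 : inner ℝ W (toL2 P (fun ω => ∫ x, v x ω * g x ∂ν)) =
      ∫ ω, ∫ x, W ω * (v x ω * g x) ∂ν ∂P := by
    rw [← integral_mul_eq_inner]
    refine integral_congr_ae ?_
    filter_upwards [coeFn_toL2 hV] with ω hω
    rw [hω, integral_const_mul]
  rw [e1, integral_integral_swap hWG]
  refine integral_eq_zero_of_ae ?_
  have hv' : ∀ᵐ x ∂ν, Integrable (fun ω => v x ω ^ 2) P := hv2.integrable_sq.prod_left_ae
  filter_upwards [hv'] with x hx
  have hvx : MemLp (v x) 2 P :=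
    (memLp_two_iff_integrable_sq ((hv x).mono hm le_rfl).aestronglyMeasurable).2 hx
  have hmem : toL2 P (v x) ∈ lpMeas ℝ ℝ m 2 P := mem_lpMeas_iff_aestronglyMeasurable.2
    ⟨v x, (hv x).stronglyMeasurable, coeFn_toL2 hvx⟩
  have h0 : inner ℝ W (toL2 P (v x)) = 0 := by
    rw [real_inner_comm]
    exact (Submodule.mem_orthogonal _ _).1 hW _ hmem
  have e2 : ∀ ω, W ω * (v x ω * g x) = g x * (W ω * v x ω) := fun ω => by ring
  simp only [e2, Pi.zero_apply]
  rw [integral_const_mul]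
  have e3 : ∫ ω, W ω * v x ω ∂P = inner ℝ W (toL2 P (v x)) := by
    rw [← integral_mul_eq_inner]
    refine integral_congr_ae ?_
    filter_upwards [coeFn_toL2 hvx] with ω hω
    rw [hω]
  rw [e3, h0, mul_zero]

/-- The initial field carries a σ-algebra independent of the noise. -/
lemma IsAdmissibleInit.exists_sigma {β : ℕ → ℤ → ℝ≥0 → Ω → ℂ} {u₀ : S2 → Ω → ℝ}
    (hu₀ : IsAdmissibleInit P β u₀) :
    ∃ m : MeasurableSpace Ω, m ≤ mΩ ∧ Indep m (noiseSigma β) P ∧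
      ∀ (l : ℕ) (k : ℤ) (z : ℂ), MemLp (fun ω => (z * initCoeff u₀ l k ω).re) 2 P ∧
        AEStronglyMeasurable[m] (fun ω => (z * initCoeff u₀ l k ω).re) P := by
  rcases hu₀ with h0 | ⟨hm, h2, -, -, -, hind, -⟩
  · refine ⟨⊥, bot_le, indep_bot_left _, fun l k z => ?_⟩
    have : (fun ω => (z * initCoeff u₀ l k ω).re) = fun _ => (0 : ℝ) := by
      funext ω
      simp [initCoeff, h0]
    rw [this]
    exact ⟨memLp_const 0, aestronglyMeasurable_const⟩
  · have hle : MeasurableSpace.comap (fun (ω : Ω) (x : S2) => u₀ x ω) inferInstance ≤ mΩ :=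
      Measurable.comap_le (measurable_pi_lambda _ hm)
    refine ⟨_, hle, (IndepFun_iff_Indep _ _ _).1 hind, fun l k z => ?_⟩
    have hcont : Continuous fun x : S2 => (z * conj (sphHarm l k x)).re := by
      have := continuous_sphHarm l k
      fun_prop
    obtain ⟨c, hc⟩ := isCompact_univ.exists_bound_of_continuousOn hcont.continuousOn
    have hmain := integral_field_mul (P := P) (ν := surfaceMeasure) hle (v := u₀)
      (fun x => (measurable_pi_apply (X := fun _ : S2 => ℝ) x).comp
        (comap_measurable (fun (ω : Ω) (x : S2) => u₀ x ω))) h2 hcont.measurable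
      (fun x => hc x (Set.mem_univ x))
    have hae : (fun ω => ∫ x, u₀ x ω * (z * conj (sphHarm l k x)).re ∂surfaceMeasure) =ᵐ[P]
        fun ω => (z * initCoeff u₀ l k ω).re := by
      have hcY := continuous_sphHarm l k
      obtain ⟨c', hc'⟩ := isCompact_univ.exists_bound_of_continuousOn hcY.continuousOn
      filter_upwards [(h2.integrable one_le_two).prod_right_ae] with ω hω
      have hi : Integrable (fun x => (u₀ x ω : ℂ) * conj (sphHarm l k x)) surfaceMeasure := by
        refine Integrable.mul_bdd (c := c') hω.ofReal ?_ (Eventually.of_forall fun x => ?_)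
        · exact (Complex.continuous_conj.comp hcY).aestronglyMeasurable
        · rw [RCLike.norm_conj]
          exact hc' x (Set.mem_univ x)
      rw [initCoeff, ← integral_const_mul]
      have h3 := integral_re (𝕜 := ℂ) (hi.const_mul z)
      simp only [RCLike.re_eq_complex_re] at h3
      rw [← h3]
      refine integral_congr_ae (Eventually.of_forall fun x => ?_)
      simp only
      rw [show z * ((u₀ x ω : ℂ) * conj (sphHarm l k x)) =
        (u₀ x ω : ℂ) * (z * conj (sphHarm l k x)) by ring, Complex.re_ofReal_mul]
    exact ⟨hmain.1.ae_eq hae, hmain.2.congr hae⟩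

end InitialField

/-! ### The modes of the noise at a point of the sphere -/

section Modes

variable {Ω : Type*} [mΩ : MeasurableSpace Ω] {P : Measure Ω} {H : ℝ}
  {β : ℕ → ℤ → ℝ≥0 → Ω → ℂ}

lemma toL2_sub {f g : Ω → ℝ} (hf : MemLp f 2 P) (hg : MemLp g 2 P) :
    toL2 P (fun ω => f ω - g ω) = toL2 P f - toL2 P g := by
  refine toL2_ext (hf.sub hg) ?_
  filter_upwards [Lp.coeFn_sub (toL2 P f) (toL2 P g), coeFn_toL2 hf, coeFn_toL2 hg] with ω h1 h2 h3
  rw [h1, Pi.sub_apply, h2, h3, Pi.sub_apply]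

lemma toL2_congr {f g : Ω → ℝ} (h : f =ᵐ[P] g) : toL2 P f = toL2 P g := by
  by_cases hf : MemLp f 2 P
  · exact toL2_ext hf ((coeFn_toL2 (hf.ae_eq h)).trans h.symm)
  · have hg : ¬ MemLp g 2 P := fun hg => hf (hg.ae_eq h.symm)
    rw [toL2, toL2, dif_neg hf, dif_neg hg]

lemma tendsto_toL2 {f : ℕ → Ω → ℝ} {g : Ω → ℝ} (hf : ∀ n, MemLp (f n) 2 P) (hg : MemLp g 2 P)
    (h : Tendsto (fun n => eLpNorm (fun ω => g ω - f n ω) 2 P) atTop (𝓝 0)) :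
    Tendsto (fun n => toL2 P (f n)) atTop (𝓝 (toL2 P g)) := by
  simp only [toL2_eq (hf _), toL2_eq hg]
  rw [Lp.tendsto_Lp_iff_tendsto_eLpNorm'' f hf g hg]
  refine h.congr fun n => ?_
  rw [eLpNorm_sub_comm]
  rfl

/-- The index `(ℓ, m)`. -/
def harmIdx {l : ℕ} {m : ℤ} (h : |m| ≤ (l : ℤ)) : HarmIdx := ⟨(l, m), h⟩

/-- The coefficient of `Re (Y_{ℓ m} β_{ℓ m})` on the real part of the noise. -/
def rePartCoeff (x : S2) (l : ℕ) (n : ℕ) : ℝ :=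
  if n = 0 then (sphHarm l 0 x).re else (sphHarm l n x).re / Real.sqrt 2

/-- The coefficient of `Re (Y_{ℓ m} β_{ℓ m})` on the imaginary part of the noise. -/
def imPartCoeff (x : S2) (l : ℕ) (n : ℕ) : ℝ :=
  if n = 0 then 0 else -(sphHarm l n x).im / Real.sqrt 2

lemma ae_re_sphHarm_mul_natCast (hβ : IsNoiseFamily P H β) (x : S2) {l n : ℕ} (hn : n ≤ l)
    (t : ℝ≥0) : (fun ω => (sphHarm l n x * β l n t ω).re) =ᵐ[P] fun ω =>
      rePartCoeff x l n * realComponent β l n t ω +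
        imPartCoeff x l n * realComponent β l (-(n : ℤ)) t ω := by
  rcases Nat.eq_zero_or_pos n with rfl | hpos
  · filter_upwards [hβ.conj_eq l 0 (by simp) t] with ω hω
    have him : (β l 0 t ω).im = 0 := by
      have h := congrArg Complex.im hω
      simp only [Complex.conj_im, neg_zero, Int.natAbs_zero, pow_zero, one_mul] at h
      linarith
    simp [rePartCoeff, imPartCoeff, realComponent, Complex.mul_re, him]
  · refine Eventually.of_forall fun ω => ?_
    have h0 : (n : ℤ) ≠ 0 := by exact_mod_cast hpos.ne'
    have h1 : (0 : ℤ) < n := by exact_mod_cast hpos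
    have h2 : Real.sqrt 2 ≠ 0 := by positivity
    simp only [rePartCoeff, imPartCoeff, realComponent, hpos.ne', h0, h1, if_false, if_true,
      neg_eq_zero, not_lt_of_gt, neg_neg, Complex.mul_re, Left.neg_pos_iff]
    field_simp
    ring

/-- The signs `(-1)^n` from `Y_{ℓ,-n}` and `β_{ℓ,-n}` cancel, and conjugation does not change the
real part. Thus `m` and `-m` carry the same real variable, which is why `modeCov` compares absolute
values. -/
lemma ae_re_sphHarm_mul_neg (hβ : IsNoiseFamily P H β) (x : S2) {l n : ℕ} (hn : n ≤ l)
    (t : ℝ≥0) : (fun ω => (sphHarm l (-(n : ℤ)) x * β l (-(n : ℤ)) t ω).re) =ᵐ[P]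
      fun ω => (sphHarm l n x * β l n t ω).re := by
  rcases Nat.eq_zero_or_pos n with rfl | hpos
  · simp
  · have hn' : |(n : ℤ)| ≤ l := by simpa using hn
    filter_upwards [hβ.conj_eq l n hn' t] with ω hω
    have hY : sphHarm l (-(n : ℤ)) x = (-1) ^ n * conj (sphHarm l n x) := by
      have h1 : ¬ (0 : ℤ) ≤ -(n : ℤ) := by omega
      have h2 : (0 : ℤ) ≤ n := by omega
      rw [sphHarm, if_neg h1, sphHarm, if_pos h2, Int.natAbs_neg]
      rfl
    rw [Int.natAbs_natCast] at hω
    have h3 : (-1 : ℂ) ^ n * (-1) ^ n = 1 := by rw [← mul_pow]; simp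
    rw [hY]
    have h4 : (-1) ^ n * conj (sphHarm l n x) * β l (-(n : ℤ)) t ω =
        conj (sphHarm l n x * β l n t ω) := by
      rw [map_mul, hω]
      ring
    rw [h4, Complex.conj_re]

/-- The process `Re (Y_{ℓ m}(x) β_{ℓ m})` in `L²(P)`. -/
def modeNoise (P : Measure Ω) (β : ℕ → ℤ → ℝ≥0 → Ω → ℂ) (x : S2) (l : ℕ) (m : ℤ) (t : ℝ≥0) :
    Lp ℝ 2 P :=
  toL2 P fun ω => (sphHarm l m x * β l m t ω).re

lemma ae_re_sphHarm_mul (hβ : IsNoiseFamily P H β) (x : S2) {l : ℕ} {m : ℤ} (hm : |m| ≤ (l : ℤ))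
    (t : ℝ≥0) : (fun ω => (sphHarm l m x * β l m t ω).re) =ᵐ[P] fun ω =>
      rePartCoeff x l m.natAbs * realComponent β l m.natAbs t ω +
        imPartCoeff x l m.natAbs * realComponent β l (-(m.natAbs : ℤ)) t ω := by
  have hn : m.natAbs ≤ l := by
    rw [Int.abs_eq_natAbs] at hm
    exact_mod_cast hm
  refine EventuallyEq.trans ?_ (ae_re_sphHarm_mul_natCast hβ x hn t)
  rcases Int.natAbs_eq m with h1 | h1
  · rw [← h1]
  · have h2 := ae_re_sphHarm_mul_neg hβ x hn t
    rw [← h1] at h2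
    exact h2

lemma abs_natAbs_le {l : ℕ} {m : ℤ} (hm : |m| ≤ (l : ℤ)) : |(m.natAbs : ℤ)| ≤ (l : ℤ) := by
  simpa using hm

lemma abs_neg_natAbs_le {l : ℕ} {m : ℤ} (hm : |m| ≤ (l : ℤ)) : |-(m.natAbs : ℤ)| ≤ (l : ℤ) := by
  simpa using hm

lemma memLp_modeNoise (hβ : IsNoiseFamily P H β) (x : S2) {l : ℕ} {m : ℤ} (hm : |m| ≤ (l : ℤ))
    (t : ℝ≥0) : MemLp (fun ω => (sphHarm l m x * β l m t ω).re) 2 P := by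
  refine MemLp.ae_eq (ae_re_sphHarm_mul hβ x hm t).symm (MemLp.add ?_ ?_)
  · exact ((hβ.fbm l _ (abs_natAbs_le hm)).memLp t).const_mul _
  · exact ((hβ.fbm l _ (abs_neg_natAbs_le hm)).memLp t).const_mul _

lemma modeNoise_eq (hβ : IsNoiseFamily P H β) (x : S2) {l : ℕ} {m : ℤ} (hm : |m| ≤ (l : ℤ))
    (t : ℝ≥0) : modeNoise P β x l m t =
      rePartCoeff x l m.natAbs • noiseVar P β (harmIdx (abs_natAbs_le hm)) t +
        imPartCoeff x l m.natAbs • noiseVar P β (harmIdx (abs_neg_natAbs_le hm)) t := by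
  have h1 := (hβ.fbm l _ (abs_natAbs_le hm)).memLp t
  have h2 := (hβ.fbm l _ (abs_neg_natAbs_le hm)).memLp t
  have h := toL2_sum_mul (P := P) Finset.univ
    ![rePartCoeff x l m.natAbs, imPartCoeff x l m.natAbs]
    (f := ![realComponent β l m.natAbs t, realComponent β l (-(m.natAbs : ℤ)) t])
    (by intro i _; fin_cases i; exacts [h1, h2])
  simp only [Fin.sum_univ_two, Matrix.cons_val_zero, Matrix.cons_val_one] at h
  rw [modeNoise, toL2_congr (ae_re_sphHarm_mul hβ x hm t), h]
  rfl

lemma modeNoise_mem (hβ : IsNoiseFamily P H β) (x : S2) {l : ℕ} {m : ℤ} (hm : |m| ≤ (l : ℤ))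
    (t : ℝ≥0) : modeNoise P β x l m t ∈ noiseSpace P β := by
  rw [modeNoise_eq hβ x hm t]
  exact (noiseSpace P β).add_mem ((noiseSpace P β).smul_mem _ (noiseVar_mem _ _))
    ((noiseSpace P β).smul_mem _ (noiseVar_mem _ _))

/-- The covariance coefficient of `Re (Y_{ℓ m} β_{ℓ m})` and `Re (Y_{ℓ' m'} β_{ℓ' m'})`. -/
def modeCov (x : S2) (l : ℕ) (m : ℤ) (l' : ℕ) (m' : ℤ) : ℝ :=
  if l = l' ∧ m.natAbs = m'.natAbs then
    rePartCoeff x l m.natAbs ^ 2 + imPartCoeff x l m.natAbs ^ 2 else 0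

lemma inner_modeNoise (hβ : IsNoiseFamily P H β) (x : S2) {l l' : ℕ} {m m' : ℤ}
    (hm : |m| ≤ (l : ℤ)) (hm' : |m'| ≤ (l' : ℤ)) (s t : ℝ≥0) :
    inner ℝ (modeNoise P β x l m s) (modeNoise P β x l' m' t) =
      modeCov x l m l' m' * fbmCov H s t := by
  rw [modeNoise_eq hβ x hm, modeNoise_eq hβ x hm', modeCov]
  simp only [inner_add_left, inner_add_right, real_inner_smul_left, real_inner_smul_right,
    inner_noiseVar hβ, harmIdx, Subtype.mk.injEq, Prod.mk.injEq]
  by_cases hl : l = l'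
  · subst hl
    by_cases hn : m.natAbs = m'.natAbs
    · rw [← hn]
      rcases Nat.eq_zero_or_pos m.natAbs with h0 | hpos
      · simp [h0, imPartCoeff]
        ring
      · have h1 : ¬ ((m.natAbs : ℤ) = -(m.natAbs : ℤ)) := by omega
        have h2 : ¬ (-(m.natAbs : ℤ) = (m.natAbs : ℤ)) := by omega
        simp only [h1, h2, and_true, and_false, if_true, if_false]
        ring
    · rcases Nat.eq_zero_or_pos m.natAbs with h0 | hpos
      · have h1 : ¬ ((m.natAbs : ℤ) = (m'.natAbs : ℤ)) := by omega
        have h2 : ¬ ((m.natAbs : ℤ) = -(m'.natAbs : ℤ)) := by omega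
        have h3 : ¬ (-(m.natAbs : ℤ) = (m'.natAbs : ℤ)) := by omega
        have h4 : ¬ (-(m.natAbs : ℤ) = -(m'.natAbs : ℤ)) := by omega
        simp only [h1, h2, h3, h4, hn, and_false, if_false]
        ring
      · have h1 : ¬ ((m.natAbs : ℤ) = (m'.natAbs : ℤ)) := by omega
        have h2 : ¬ ((m.natAbs : ℤ) = -(m'.natAbs : ℤ)) := by omega
        have h3 : ¬ (-(m.natAbs : ℤ) = (m'.natAbs : ℤ)) := by omega
        have h4 : ¬ (-(m.natAbs : ℤ) = -(m'.natAbs : ℤ)) := by omega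
        simp only [h1, h2, h3, h4, hn, and_false, if_false]
        ring
  · simp only [hl, false_and, if_false]
    ring

/-- For `m ≠ 0` the two factors `1/√2` leave `|Y_{ℓ m}|²/2`, and both `m' = m` and `m' = -m`
contribute, which restores `|Y_{ℓ m}|²`. For `m = 0` the harmonic is real. The addition theorem then
sums over `m`. -/
lemma sum_modeCov (x : S2) (l : ℕ) :
    ∑ m ∈ Finset.Icc (-(l : ℤ)) (l : ℤ), ∑ m' ∈ Finset.Icc (-(l : ℤ)) (l : ℤ),
      modeCov x l m l m' = (2 * l + 1) / (4 * Real.pi) := by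
  rw [← sum_sq_norm_sphHarm l x]
  refine Finset.sum_congr rfl fun m hm => ?_
  have h := sum_Icc_natAbs l (fun n => if m.natAbs = n then
    rePartCoeff x l m.natAbs ^ 2 + imPartCoeff x l m.natAbs ^ 2 else 0)
  simp only [modeCov, true_and]
  rw [h, norm_sphHarm]
  have hre : ∀ n : ℕ, sphHarm l n x = sphHarmNonneg l n x := fun n => by
    rw [sphHarm, if_pos (by omega)]
    rfl
  have hml : m.natAbs ≤ l := by
    rw [Finset.mem_Icc] at hm
    omega
  generalize m.natAbs = n at hml
  rcases n with _ | n
  · have him : (sphHarmNonneg l 0 x).im = 0 := by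
      simp only [sphHarmNonneg, pow_zero, one_mul, mul_one, ← Complex.ofReal_mul,
        Complex.ofReal_im]
    have h0 := hre 0
    rw [Nat.cast_zero] at h0
    rw [← Complex.normSq_eq_norm_sq, Complex.normSq_apply, him]
    simp [rePartCoeff, imPartCoeff, h0, sq]
  · have hs : Real.sqrt 2 ^ 2 = 2 := Real.sq_sqrt (by norm_num)
    simp only [Nat.add_right_cancel_iff, Nat.add_eq_zero_iff, one_ne_zero, and_false, if_false,
      mul_ite, mul_zero, zero_add, Finset.sum_ite_eq, Finset.mem_range, Nat.lt_of_succ_le hml,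
      if_true]
    rw [← Complex.normSq_eq_norm_sq, Complex.normSq_apply, rePartCoeff, imPartCoeff, hre,
      if_neg (by omega), if_neg (by omega), div_pow, div_pow, hs]
    ring

lemma integralCurve_modeNoise (hβ : IsNoiseFamily P H β) (x : S2) {l : ℕ} {m : ℤ}
    (hm : |m| ≤ (l : ℤ)) {T : ℝ≥0} (σ : StepFun T) :
    MemLp (fun ω => (sphHarm l m x * σ.integral (β l m) ω).re) 2 P ∧
      toL2 P (fun ω => (sphHarm l m x * σ.integral (β l m) ω).re) =
        σ.integralCurve (modeNoise P β x l m) := by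
  have hM := memLp_modeNoise hβ x hm
  have e : (fun ω => (sphHarm l m x * σ.integral (β l m) ω).re) = fun ω =>
      ∑ i, σ.coeff i * ((sphHarm l m x * β l m (σ.right i) ω).re -
        (sphHarm l m x * β l m (σ.left i) ω).re) := by
    funext ω
    rw [StepFun.integral, Finset.mul_sum, Complex.re_sum]
    refine Finset.sum_congr rfl fun i _ => ?_
    rw [show sphHarm l m x * ((σ.coeff i : ℂ) * (β l m (σ.right i) ω - β l m (σ.left i) ω)) =
      (σ.coeff i : ℂ) * (sphHarm l m x * β l m (σ.right i) ω -
        sphHarm l m x * β l m (σ.left i) ω) by ring, Complex.re_ofReal_mul, Complex.sub_re]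
  have hi : ∀ i ∈ Finset.univ, MemLp (fun ω => (sphHarm l m x * β l m (σ.right i) ω).re -
        (sphHarm l m x * β l m (σ.left i) ω).re) 2 P :=
    fun i _ => (hM _).sub (hM _)
  rw [e]
  refine ⟨memLp_finsetSum _ fun i hi' => (hi i hi').const_mul _, ?_⟩
  rw [toL2_sum_mul Finset.univ σ.coeff hi, StepFun.integralCurve]
  refine Finset.sum_congr rfl fun i _ => ?_
  rw [toL2_sub (hM _) (hM _)]
  rfl

lemma tendsto_integralCurve_modeNoise (hβ : IsNoiseFamily P H β) (x : S2) {l : ℕ} {m : ℤ}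
    (hm : |m| ≤ (l : ℤ)) {T : ℝ≥0} {φ : ℝ → ℝ} {I : Ω → ℂ}
    (hI : IsWienerIntegral P H T φ (β l m) I) :
    MemLp (fun ω => (sphHarm l m x * I ω).re) 2 P ∧ ∃ σ : ℕ → StepFun T,
      Tendsto (fun n => energy H T (fun s => φ s - (σ n).eval s)) atTop (𝓝 0) ∧
      Tendsto (fun n => (σ n).integralCurve (modeNoise P β x l m)) atTop
        (𝓝 (toL2 P fun ω => (sphHarm l m x * I ω).re)) := by
  obtain ⟨-, -, hI2, σ, hσ, hlim⟩ := hI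
  have hre : MemLp (fun ω => (sphHarm l m x * I ω).re) 2 P := (hI2.const_mul (sphHarm l m x)).re
  refine ⟨hre, σ, hσ, ?_⟩
  have hn := fun n => integralCurve_modeNoise hβ x hm (σ n)
  have h := tendsto_toL2 (fun n => (hn n).1) hre ?_
  · exact h.congr fun n => (hn n).2
  · have hz : Tendsto (fun n => ENNReal.ofReal ‖sphHarm l m x‖ *
        eLpNorm (fun ω => I ω - (σ n).integral (β l m) ω) 2 P) atTop (𝓝 0) := by
      have := ENNReal.Tendsto.const_mul hlim (Or.inr (ENNReal.ofReal_ne_top (r := ‖sphHarm l m x‖)))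
      rwa [mul_zero] at this
    refine tendsto_of_tendsto_of_tendsto_of_le_of_le tendsto_const_nhds hz (fun _ => zero_le)
      fun n => ?_
    refine eLpNorm_le_mul_eLpNorm_of_ae_le_mul (Eventually.of_forall fun ω => ?_) 2
    rw [← Complex.sub_re, ← mul_sub, ← norm_mul]
    exact Complex.abs_re_le_norm _

end Modes

/-! ### The stochastic convolution at a point of the sphere -/

section Convolution

/-- A squared distance is a quadratic form in the Gram matrix, so proportional Gram matrices give
proportional distances with the same coefficients `a`. -/
lemma norm_sq_sub_sum_smul {E F ι : Type*} [NormedAddCommGroup E] [InnerProductSpace ℝ E]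
    [NormedAddCommGroup F] [InnerProductSpace ℝ F] {f : ℝ≥0 → E} {g : ℝ≥0 → F} {c : ℝ} {T : ℝ≥0}
    (h : ∀ s ≤ T, ∀ t ≤ T, inner ℝ (f s) (f t) = c * inner ℝ (g s) (g t)) {t : ℝ≥0} (ht : t ≤ T)
    (I : Finset ι) (a : ι → ℝ) {s : ι → ℝ≥0} (hs : ∀ i ∈ I, s i ≤ T) :
    ‖f t - ∑ i ∈ I, a i • f (s i)‖ ^ 2 = c * ‖g t - ∑ i ∈ I, a i • g (s i)‖ ^ 2 := by
  have h1 : ∑ i ∈ I, 2 * (a i * inner ℝ (f t) (f (s i))) =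
      ∑ i ∈ I, c * (2 * (a i * inner ℝ (g t) (g (s i)))) := by
    refine Finset.sum_congr rfl fun i hi => ?_
    rw [h t ht _ (hs i hi)]
    ring
  have h2 : ∑ i ∈ I, ∑ j ∈ I, a i * (a j * inner ℝ (f (s j)) (f (s i))) =
      ∑ i ∈ I, ∑ j ∈ I, c * (a i * (a j * inner ℝ (g (s j)) (g (s i)))) := by
    refine Finset.sum_congr rfl fun i hi => Finset.sum_congr rfl fun j hj => ?_
    rw [h _ (hs j hj) _ (hs i hi)]
    ring
  rw [norm_sub_sq_real, norm_sub_sq_real]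
  simp only [← real_inner_self_eq_norm_sq, inner_sum, sum_inner, real_inner_smul_left,
    real_inner_smul_right, Finset.mul_sum, mul_add, mul_sub]
  rw [h t ht t ht, h1, h2]

variable {Ω : Type*} [mΩ : MeasurableSpace Ω] {P : Measure Ω} {H : ℝ}
  {β J : ℕ → ℤ → ℝ≥0 → Ω → ℂ} {T : ℝ≥0}

/-- `Re (Y_{ℓ m}(x) J_{ℓ m}(t))` in `L²(P)`. -/
def modeConv (P : Measure Ω) (J : ℕ → ℤ → ℝ≥0 → Ω → ℂ) (x : S2) (l : ℕ) (m : ℤ) (t : ℝ≥0) :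
    Lp ℝ 2 P :=
  toL2 P fun ω => (sphHarm l m x * J l m t ω).re

/-- `∑_m Re (Y_{ℓ m}(x) J_{ℓ m}(t))` in `L²(P)`. -/
def modeConvSum (P : Measure Ω) (J : ℕ → ℤ → ℝ≥0 → Ω → ℂ) (x : S2) (l : ℕ) (t : ℝ≥0) : Lp ℝ 2 P :=
  ∑ m ∈ Finset.Icc (-(l : ℤ)) (l : ℤ), modeConv P J x l m t

/-- The constant of the isometry between the integrals and the fractional potentials. -/
def isoConst (H : ℝ) : ℝ := H * (2 * H - 1) / fracConst H

lemma isoConst_pos (hH : 1 / 2 < H) (hH1 : H < 1) : 0 < isoConst H := by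
  have h1 := fracConst_pos hH hH1
  have h2 : 0 < 2 * H - 1 := by linarith
  have h3 : 0 < H := by linarith
  unfold isoConst
  positivity

/-- `J` is the family of the stochastic convolutions of the modes. -/
def IsModeConvolution (P : Measure Ω) (H : ℝ) (T : ℝ≥0) (β J : ℕ → ℤ → ℝ≥0 → Ω → ℂ) : Prop :=
  ∀ (l : ℕ) (m : ℤ), |m| ≤ (l : ℤ) → ∀ t ≤ T,
    IsWienerIntegral P H T (heatKernelMode l t) (β l m) (J l m t)

/-- The isometry applied to the real noises `Re(Y β)`, whose mutual covariances are all multiples of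
that of fractional Brownian motion. -/
lemma inner_modeConv (hH : 1 / 2 < H) (hH1 : H < 1) (hβ : IsNoiseFamily P H β)
    (hJ : IsModeConvolution P H T β J) (x : S2) {l l' : ℕ} {m m' : ℤ} (hm : |m| ≤ (l : ℤ))
    (hm' : |m'| ≤ (l' : ℤ)) {s t : ℝ≥0} (hs : s ≤ T) (ht : t ≤ T) :
    inner ℝ (modeConv P J x l m s) (modeConv P J x l' m' t) =
      modeCov x l m l' m' * isoConst H *
        inner ℝ (fracL2 H (heatKernelMode l s)) (fracL2 H (heatKernelMode l' t)) := by
  obtain ⟨-, σ, hσ, hσ'⟩ := tendsto_integralCurve_modeNoise hβ x hm (hJ l m hm s hs)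
  obtain ⟨-, τ, hτ, hτ'⟩ := tendsto_integralCurve_modeNoise hβ x hm' (hJ l' m' hm' t ht)
  exact inner_eq_of_tendsto_integralCurve hH hH1 (inner_modeNoise hβ x hm hm')
    (isTestFun_heatKernelMode l hs) (isTestFun_heatKernelMode l' ht) hσ hτ hσ' hτ'

lemma modeConv_mem (hβ : IsNoiseFamily P H β) (hJ : IsModeConvolution P H T β J) (x : S2) {l : ℕ}
    {m : ℤ} (hm : |m| ≤ (l : ℤ)) {t : ℝ≥0} (ht : t ≤ T) :
    modeConv P J x l m t ∈ noiseSpace P β := by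
  obtain ⟨-, σ, -, hσ⟩ := tendsto_integralCurve_modeNoise hβ x hm (hJ l m hm t ht)
  refine (Submodule.isClosed_topologicalClosure _).mem_of_tendsto hσ (Eventually.of_forall
    fun n => ?_)
  exact (noiseSpace P β).sum_mem fun i _ => (noiseSpace P β).smul_mem _
    ((noiseSpace P β).sub_mem (modeNoise_mem hβ x hm _) (modeNoise_mem hβ x hm _))

lemma abs_le_of_mem_Icc {l : ℕ} {m : ℤ} (hm : m ∈ Finset.Icc (-(l : ℤ)) (l : ℤ)) :
    |m| ≤ (l : ℤ) :=
  abs_le.2 (Finset.mem_Icc.1 hm)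

lemma modeConvSum_mem (hβ : IsNoiseFamily P H β) (hJ : IsModeConvolution P H T β J) (x : S2)
    (l : ℕ) {t : ℝ≥0} (ht : t ≤ T) : modeConvSum P J x l t ∈ noiseSpace P β :=
  (noiseSpace P β).sum_mem fun _ hm => modeConv_mem hβ hJ x (abs_le_of_mem_Icc hm) ht

lemma inner_modeConvSum (hH : 1 / 2 < H) (hH1 : H < 1) (hβ : IsNoiseFamily P H β)
    (hJ : IsModeConvolution P H T β J) (x : S2) (l : ℕ) :
    ∀ s ≤ T, ∀ t ≤ T, inner ℝ (modeConvSum P J x l s) (modeConvSum P J x l t) =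
      (2 * l + 1) / (4 * Real.pi) * isoConst H *
        inner ℝ (fracL2 H (heatKernelMode l s)) (fracL2 H (heatKernelMode l t)) := by
  intro s hs t ht
  rw [← sum_modeCov x l, Finset.sum_mul, Finset.sum_mul, modeConvSum, modeConvSum, sum_inner]
  refine Finset.sum_congr rfl fun m hm => ?_
  rw [inner_sum, Finset.sum_mul, Finset.sum_mul]
  refine Finset.sum_congr rfl fun m' hm' => ?_
  exact inner_modeConv hH hH1 hβ hJ x (abs_le_of_mem_Icc hm) (abs_le_of_mem_Icc hm') hs ht

lemma inner_modeConvSum_of_ne (hH : 1 / 2 < H) (hH1 : H < 1) (hβ : IsNoiseFamily P H β)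
    (hJ : IsModeConvolution P H T β J) (x : S2) {l l' : ℕ} (hl : l ≠ l') {s t : ℝ≥0}
    (hs : s ≤ T) (ht : t ≤ T) : inner ℝ (modeConvSum P J x l s) (modeConvSum P J x l' t) = 0 := by
  rw [modeConvSum, modeConvSum, sum_inner]
  refine Finset.sum_eq_zero fun m hm => ?_
  rw [inner_sum]
  refine Finset.sum_eq_zero fun m' hm' => ?_
  rw [inner_modeConv hH hH1 hβ hJ x (abs_le_of_mem_Icc hm) (abs_le_of_mem_Icc hm') hs ht, modeCov,
    if_neg (fun h => hl h.1), zero_mul, zero_mul]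

/-- Orthogonality of the modes turns a lower bound for finitely many of them into a lower bound for
the whole series. -/
lemma le_norm_sq_sub_sum (hH : 1 / 2 < H) (hH1 : H < 1) (hβ : IsNoiseFamily P H β)
    (hJ : IsModeConvolution P H T β J) (x : S2) {C : ℕ → ℝ} (hC : ∀ l, 0 ≤ C l)
    {N : ℝ≥0 → Lp ℝ 2 P} (hN : ∀ t ≤ T, Tendsto (fun L : ℕ => ∑ l ∈ Finset.range L,
      Real.sqrt (C l) • modeConvSum P J x l t) atTop (𝓝 (N t)))
    {t : ℝ≥0} (ht : t ≤ T) {r : ℝ} (hr : 0 < r) (hrt : r ≤ t) {ι : Type*} (I : Finset ι)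
    (a : ι → ℝ) {s : ι → ℝ≥0} (hs : ∀ i ∈ I, s i ≤ T ∧ r ≤ (t : ℝ) - s i) (n : ℕ) :
    ∑ l ∈ Finset.range n, C l * ((2 * l + 1) / (4 * Real.pi) * isoConst H *
      (modeConst H * Real.exp (-(2 * ((l : ℝ) * (l + 1) * r))) * r ^ (2 * H))) ≤
      ‖N t - ∑ i ∈ I, a i • N (s i)‖ ^ 2 := by
  set Q : ℕ → Lp ℝ 2 P := fun l => modeConvSum P J x l t - ∑ i ∈ I, a i • modeConvSum P J x l (s i)
    with hQ
  have hiso := isoConst_pos hH hH1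
  have hQn : ∀ l : ℕ, (2 * l + 1) / (4 * Real.pi) * isoConst H *
      (modeConst H * Real.exp (-(2 * ((l : ℝ) * (l + 1) * r))) * r ^ (2 * H)) ≤ ‖Q l‖ ^ 2 := by
    intro l
    rw [hQ]
    simp only
    rw [norm_sq_sub_sum_smul (inner_modeConvSum hH hH1 hβ hJ x l) ht I a fun i hi => (hs i hi).1]
    exact mul_le_mul_of_nonneg_left (le_norm_sq_mode_sub hH hH1 l hr hrt I a s fun i hi =>
      (hs i hi).2) (by positivity)
  have hQ0 : ∀ l l', l ≠ l' → inner ℝ (Q l) (Q l') = 0 := by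
    intro l l' hl
    have h0 : ∀ s ≤ T, ∀ t ≤ T, inner ℝ (modeConvSum P J x l s) (modeConvSum P J x l' t) = 0 :=
      fun s hs t ht => inner_modeConvSum_of_ne hH hH1 hβ hJ x hl hs ht
    have h1 : inner ℝ (modeConvSum P J x l t) (∑ i ∈ I, a i • modeConvSum P J x l' (s i)) = 0 := by
      rw [inner_sum]
      refine Finset.sum_eq_zero fun i hi => ?_
      rw [real_inner_smul_right, h0 t ht _ (hs i hi).1, mul_zero]
    have h2 : ∀ q ≤ T,
        inner ℝ (∑ i ∈ I, a i • modeConvSum P J x l (s i)) (modeConvSum P J x l' q) = 0 := by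
      intro q hq
      rw [sum_inner]
      refine Finset.sum_eq_zero fun i hi => ?_
      rw [real_inner_smul_left, h0 _ (hs i hi).1 q hq, mul_zero]
    have h3 : inner ℝ (∑ i ∈ I, a i • modeConvSum P J x l (s i))
        (∑ i ∈ I, a i • modeConvSum P J x l' (s i)) = 0 := by
      rw [inner_sum]
      refine Finset.sum_eq_zero fun i hi => ?_
      rw [real_inner_smul_right, h2 _ (hs i hi).1, mul_zero]
    simp only [hQ]
    rw [inner_sub_left, inner_sub_right, inner_sub_right, h0 t ht t ht, h1, h2 t ht, h3]
    simp
  have hlim : Tendsto (fun L : ℕ => ∑ l ∈ Finset.range L, Real.sqrt (C l) • Q l) atTop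
      (𝓝 (N t - ∑ i ∈ I, a i • N (s i))) := by
    have h1 := (hN t ht).sub (tendsto_finsetSum I fun i hi =>
      (hN (s i) (hs i hi).1).const_smul (a i))
    refine h1.congr fun L => ?_
    simp only [hQ, smul_sub, Finset.sum_sub_distrib, Finset.smul_sum]
    rw [Finset.sum_comm]
    congr 1
    refine Finset.sum_congr rfl fun l _ => Finset.sum_congr rfl fun i _ => ?_
    rw [smul_comm]
  -- Pythagoras: the differences `Q l` of distinct degrees are orthogonal although they share the
  -- coefficients `a`.
  have hnorm : ∀ L : ℕ, ‖∑ l ∈ Finset.range L, Real.sqrt (C l) • Q l‖ ^ 2 =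
      ∑ l ∈ Finset.range L, C l * ‖Q l‖ ^ 2 := by
    intro L
    rw [← real_inner_self_eq_norm_sq, sum_inner]
    refine Finset.sum_congr rfl fun l hl => ?_
    rw [inner_sum, Finset.sum_eq_single l]
    · rw [real_inner_smul_left, real_inner_smul_right, real_inner_self_eq_norm_sq, ← mul_assoc,
        Real.mul_self_sqrt (hC l)]
    · intro l' _ hne
      rw [real_inner_smul_left, real_inner_smul_right, hQ0 l l' hne.symm, mul_zero, mul_zero]
    · exact fun h => absurd hl h
  refine ge_of_tendsto ((hlim.norm).pow 2) ?_
  -- Every partial sum beyond `n` already exceeds the truncated bound, so the limit does too.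
  filter_upwards [eventually_ge_atTop n] with L hL
  rw [hnorm]
  refine (Finset.sum_le_sum fun (l : ℕ) _ => mul_le_mul_of_nonneg_left (hQn l) (hC l)).trans ?_
  exact Finset.sum_le_sum_of_subset_of_nonneg (Finset.range_subset_range.2 hL)
    fun l _ _ => mul_nonneg (hC l) (sq_nonneg _)

end Convolution

/-! ### The decomposition of the mild solution -/

section Decomposition

/-- Independent square integrable variables, one of them centred, are orthogonal. -/
lemma inner_eq_zero_of_indep {Ω : Type*} {m₁ m₂ : MeasurableSpace Ω} [mΩ : MeasurableSpace Ω]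
    {P : Measure Ω} {X Y : Lp ℝ 2 P} (hX : AEStronglyMeasurable[m₁] X P)
    (hY : AEStronglyMeasurable[m₂] Y P) (h : Indep m₁ m₂ P) (hY0 : ∫ ω, Y ω ∂P = 0) :
    inner ℝ X Y = 0 := by
  have hX1 : hX.mk X =ᵐ[P] X := hX.ae_eq_mk.symm
  have hY1 : hY.mk Y =ᵐ[P] Y := hY.ae_eq_mk.symm
  have hind : IndepFun (hX.mk X) (hY.mk Y) P := by
    rw [IndepFun_iff_Indep]
    exact indep_of_indep_of_le h (hX.stronglyMeasurable_mk.measurable.comap_le)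
      (hY.stronglyMeasurable_mk.measurable.comap_le)
  have h1 := (hind.congr hX1 hY1).integral_mul_eq_mul_integral (Lp.aestronglyMeasurable X)
    (Lp.aestronglyMeasurable Y)
  rw [← integral_mul_eq_inner]
  refine h1.trans ?_
  rw [hY0, mul_zero]

variable {Ω : Type*} [mΩ : MeasurableSpace Ω] {P : Measure Ω}

lemma toL2_add {f g : Ω → ℝ} (hf : MemLp f 2 P) (hg : MemLp g 2 P) :
    toL2 P (fun ω => f ω + g ω) = toL2 P f + toL2 P g := by
  refine toL2_ext (hf.add hg) ?_
  filter_upwards [Lp.coeFn_add (toL2 P f) (toL2 P g), coeFn_toL2 hf, coeFn_toL2 hg] with ω h1 h2 h3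
  rw [h1, Pi.add_apply, h2, h3, Pi.add_apply]

lemma toL2_const_mul {f : Ω → ℝ} (hf : MemLp f 2 P) (a : ℝ) :
    toL2 P (fun ω => a * f ω) = a • toL2 P f := by
  refine toL2_ext (hf.const_mul a) ?_
  filter_upwards [Lp.coeFn_smul a (toL2 P f), coeFn_toL2 hf] with ω h1 h2
  rw [h1, Pi.smul_apply, h2, smul_eq_mul]

lemma toL2_sum {ι : Type*} (I : Finset ι) {f : ι → Ω → ℝ} (hf : ∀ i ∈ I, MemLp (f i) 2 P) :
    toL2 P (fun ω => ∑ i ∈ I, f i ω) = ∑ i ∈ I, toL2 P (f i) := by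
  simpa using toL2_sum_mul I (fun _ => 1) hf

end Decomposition

section Solution

variable {Ω : Type*} [mΩ : MeasurableSpace Ω] {P : Measure Ω} {H : ℝ}
  {β : ℕ → ℤ → ℝ≥0 → Ω → ℂ} {T : ℝ≥0}

instance (β : ℕ → ℤ → ℝ≥0 → Ω → ℂ) : (noiseSpace P β).HasOrthogonalProjection := by
  unfold noiseSpace
  infer_instance

/-- The decomposition of the mild solution: it is square integrable, its projection on the noise
space is the sum of the stochastic convolutions, and the rest is measurable with respect to the
initial field. -/
lemma IsMildSolution.decomposition {Ω : Type*} {m₀ : MeasurableSpace Ω} [mΩ : MeasurableSpace Ω]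
    {P : Measure Ω} [IsProbabilityMeasure P] {H : ℝ} {β J : ℕ → ℤ → ℝ≥0 → Ω → ℂ} {T : ℝ≥0}
    (hβ : IsNoiseFamily P H β) (hJ : IsModeConvolution P H T β J) {u₀ : S2 → Ω → ℝ}
    (hm₀ : m₀ ≤ mΩ) (hind : Indep m₀ (noiseSigma β) P)
    (hu₀ : ∀ (l : ℕ) (k : ℤ) (z : ℂ), MemLp (fun ω => (z * initCoeff u₀ l k ω).re) 2 P ∧
        AEStronglyMeasurable[m₀] (fun ω => (z * initCoeff u₀ l k ω).re) P)
    {C : ℕ → ℝ} {x : S2} {t : ℝ≥0} (ht : t ≤ T) {U : Ω → ℝ} (hU : Measurable U)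
    (hlim : Tendsto (fun L : ℕ => eLpNorm (fun ω => (U ω : ℂ) -
        ∑ l ∈ Finset.range L, ∑ m ∈ Finset.Icc (-(l : ℤ)) (l : ℤ),
          ((Real.exp (-((l : ℝ) * ((l : ℝ) + 1)) * (t : ℝ)) : ℂ) * initCoeff u₀ l m ω +
            (Real.sqrt (C l) : ℂ) * J l m t ω) * sphHarm l m x) 2 P) atTop (𝓝 0)) :
    MemLp U 2 P ∧
      Tendsto (fun L : ℕ => ∑ l ∈ Finset.range L, Real.sqrt (C l) • modeConvSum P J x l t) atTop
        (𝓝 ((noiseSpace P β).starProjection (toL2 P U))) ∧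
      AEStronglyMeasurable[m₀] (toL2 P U - (noiseSpace P β).starProjection (toL2 P U) : Lp ℝ 2 P)
        P := by
  set a : ℕ → ℤ → Ω → ℝ := fun l m ω =>
    ((Real.exp (-((l : ℝ) * ((l : ℝ) + 1)) * (t : ℝ)) : ℂ) * sphHarm l m x *
      initCoeff u₀ l m ω).re with ha
  set v : ℕ → ℤ → Ω → ℝ := fun l m ω => (sphHarm l m x * J l m t ω).re with hv
  have ha2 : ∀ l m, MemLp (a l m) 2 P := fun l m => (hu₀ l m _).1
  have hv2 : ∀ (l : ℕ) (m : ℤ), |m| ≤ (l : ℤ) → MemLp (v l m) 2 P := fun l m hm =>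
    (tendsto_integralCurve_modeNoise hβ x hm (hJ l m hm t ht)).1
  set S : ℕ → Ω → ℝ := fun L ω => ∑ l ∈ Finset.range L, ∑ m ∈ Finset.Icc (-(l : ℤ)) (l : ℤ),
    (a l m ω + Real.sqrt (C l) * v l m ω) with hS
  have hterm : ∀ (l : ℕ), ∀ m ∈ Finset.Icc (-(l : ℤ)) (l : ℤ),
      MemLp (fun ω => a l m ω + Real.sqrt (C l) * v l m ω) 2 P := fun l m hm =>
    (ha2 l m).add ((hv2 l m (abs_le_of_mem_Icc hm)).const_mul _)
  have hS2 : ∀ L, MemLp (S L) 2 P := fun L =>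
    memLp_finsetSum _ fun l _ => memLp_finsetSum _ fun m hm => hterm l m hm
  have hSL : ∀ L, toL2 P (S L) = (∑ l ∈ Finset.range L, ∑ m ∈ Finset.Icc (-(l : ℤ)) (l : ℤ),
      toL2 P (a l m)) + ∑ l ∈ Finset.range L, Real.sqrt (C l) • modeConvSum P J x l t := by
    intro L
    rw [hS, toL2_sum _ fun (l : ℕ) _ => memLp_finsetSum _ fun m hm => hterm l m hm,
      ← Finset.sum_add_distrib]
    refine Finset.sum_congr rfl fun l _ => ?_
    rw [toL2_sum _ (hterm l), modeConvSum, Finset.smul_sum, ← Finset.sum_add_distrib]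
    refine Finset.sum_congr rfl fun m hm => ?_
    have hvm := hv2 l m (abs_le_of_mem_Icc hm)
    rw [toL2_add (ha2 l m) (hvm.const_mul _), toL2_const_mul hvm]
    rfl
  -- `U` is real, so only the real parts of the partial sums matter for the convergence.
  have hlim' : Tendsto (fun L => eLpNorm (fun ω => U ω - S L ω) 2 P) atTop (𝓝 0) := by
    refine tendsto_of_tendsto_of_tendsto_of_le_of_le tendsto_const_nhds hlim (fun _ => zero_le)
      fun L => eLpNorm_mono_ae (Eventually.of_forall fun ω => ?_)
    refine le_trans (le_of_eq ?_) (Complex.abs_re_le_norm _)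
    rw [Real.norm_eq_abs, Complex.sub_re, Complex.ofReal_re, Complex.re_sum]
    congr 2
    refine Finset.sum_congr rfl fun l _ => ?_
    rw [Complex.re_sum]
    refine Finset.sum_congr rfl fun m _ => ?_
    rw [add_mul, Complex.add_re, ha, hv]
    simp only
    rw [← Complex.re_ofReal_mul]
    congr 2 <;> ring
  have hU2 : MemLp U 2 P := by
    obtain ⟨L, hL⟩ := (hlim'.eventually (gt_mem_nhds ENNReal.zero_lt_top)).exists
    have hd : MemLp (fun ω => U ω - S L ω) 2 P := ⟨hU.aestronglyMeasurable.sub (hS2 L).1, hL⟩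
    have e : (fun ω => U ω - S L ω) + S L = U := by
      funext ω
      simp
    exact e ▸ hd.add (hS2 L)
  have hSU : Tendsto (fun L => toL2 P (S L)) atTop (𝓝 (toL2 P U)) := tendsto_toL2 hS2 hU2 hlim'
  -- The initial terms are independent of the noise, whose elements are centred, so the projection
  -- kills them; it fixes the convolutions. Continuity of the projection then yields convergence of
  -- the noise series by itself, which is not assumed.
  have hproj : ∀ L, (noiseSpace P β).starProjection (toL2 P (S L)) =
      ∑ l ∈ Finset.range L, Real.sqrt (C l) • modeConvSum P J x l t := by
    intro L
    rw [hSL, map_add, map_sum, Finset.sum_eq_zero, zero_add,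
      Submodule.starProjection_eq_self_iff.2]
    · exact Submodule.sum_mem _ fun l _ => Submodule.smul_mem _ _ (modeConvSum_mem hβ hJ x l ht)
    · intro l _
      rw [map_sum]
      refine Finset.sum_eq_zero fun m _ => ?_
      rw [Submodule.starProjection_apply_eq_zero_iff, Submodule.mem_orthogonal']
      intro Y hY
      refine inner_eq_zero_of_indep (m₁ := m₀) (m₂ := noiseSigma β) ?_
        (aestronglyMeasurable_of_mem_noiseSpace hβ hY) hind (isGaussianSpace_noiseSpace hβ Y hY).2
      exact (hu₀ l m _).2.congr (coeFn_toL2 (ha2 l m)).symm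
  have hN := ((noiseSpace P β).starProjection.continuous.tendsto (toL2 P U)).comp hSU
  refine ⟨hU2, hN.congr hproj, ?_⟩
  refine (isClosed_aestronglyMeasurable (F := ℝ) (p := 2) (μ := P) hm₀).mem_of_tendsto
    (hSU.sub hN) (Eventually.of_forall fun L => ?_)
  have e : toL2 P (S L) - ((noiseSpace P β).starProjection ∘ fun L => toL2 P (S L)) L =
      ∑ l ∈ Finset.range L, ∑ m ∈ Finset.Icc (-(l : ℤ)) (l : ℤ), toL2 P (a l m) := by
    rw [Function.comp_apply, hproj, hSL, add_sub_cancel_right]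
  rw [e]
  have hmem : ∑ l ∈ Finset.range L, ∑ m ∈ Finset.Icc (-(l : ℤ)) (l : ℤ), toL2 P (a l m) ∈
      lpMeas ℝ ℝ m₀ 2 P :=
    Submodule.sum_mem _ fun l _ => Submodule.sum_mem _ fun m _ =>
      mem_lpMeas_iff_aestronglyMeasurable.2 ((hu₀ l m _).2.congr (coeFn_toL2 (ha2 l m)).symm)
  exact mem_lpMeas_iff_aestronglyMeasurable.1 hmem

end Solution

/-! ### Conditional variance in a Gaussian space -/

/-- If `𝓔` is complete, `U s - N s` for `s ∈ insert t A`, `N s` for `s ∈ A` and `N t - D` are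
`𝓔`-measurable, and `D` is centred and independent of `𝓔`, then the conditional variance of `U t`
given the `U s`, `s ∈ A`, is at least the variance of `D`. -/
lemma le_condVar_of_indep_sub {Ω : Type*} {𝓔 : MeasurableSpace Ω} [mΩ : MeasurableSpace Ω]
    {P : Measure Ω} [IsProbabilityMeasure P] {ι : Type*} {U : ι → Ω → ℝ} {N : ι → Lp ℝ 2 P}
    {t : ι} {A : Set ι} {D : Lp ℝ 2 P}
    (h𝓔 : ∀ f g : Ω → ℝ, Measurable[𝓔] f → g =ᵐ[P] f → Measurable[𝓔] g)
    (hU : ∀ s ∈ insert t A, Measurable (U s)) (hU2 : ∀ s ∈ insert t A, MemLp (U s) 2 P)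
    (hR : ∀ s ∈ insert t A, Measurable[𝓔] ((toL2 P (U s) - N s : Lp ℝ 2 P) : Ω → ℝ))
    (hN : ∀ s ∈ A, Measurable[𝓔] (N s : Ω → ℝ))
    (hND : Measurable[𝓔] ((N t - D : Lp ℝ 2 P) : Ω → ℝ)) (hD0 : ∫ ω, D ω ∂P = 0)
    (hind : Indep (MeasurableSpace.comap (D : Ω → ℝ) inferInstance) 𝓔 P) :
    ∀ᵐ ω ∂P, ‖D‖ ^ 2 ≤ (Var[U t; P | ⨆ s ∈ A, MeasurableSpace.comap (U s) inferInstance]) ω := by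
  have hG : ⨆ s ∈ A, MeasurableSpace.comap (U s) inferInstance ≤ mΩ :=
    iSup₂_le fun s hs => (hU s (Set.mem_insert_of_mem t hs)).comap_le
  have hG𝓔 : ⨆ s ∈ A, MeasurableSpace.comap (U s) inferInstance ≤ 𝓔 := by
    refine iSup₂_le fun s hs => ?_
    have hs' := Set.mem_insert_of_mem t hs
    refine Measurable.comap_le (h𝓔 _ _ ((hR s hs').add (hN s hs)) ?_)
    filter_upwards [coeFn_toL2 (hU2 s hs'), Lp.coeFn_sub (toL2 P (U s)) (N s)] with ω h1 h2
    rw [Pi.add_apply, h2, Pi.sub_apply, h1, sub_add_cancel]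
  have ht' := Set.mem_insert t A
  have hRt : Measurable[𝓔] fun ω => U t ω - D ω := by
    refine h𝓔 _ _ ((hR t ht').add hND) ?_
    filter_upwards [coeFn_toL2 (hU2 t ht'), Lp.coeFn_sub (toL2 P (U t)) (N t),
      Lp.coeFn_sub (N t) D] with ω h1 h2 h3
    rw [Pi.add_apply, h2, h3, Pi.sub_apply, Pi.sub_apply, h1]
    ring
  have hDn : ∫ ω, D ω ^ 2 ∂P = ‖D‖ ^ 2 := by
    rw [← real_inner_self_eq_norm_sq, ← integral_mul_eq_inner]
    simp only [sq]
  exact hDn ▸ le_condVar_of_indep hG hG𝓔 (hU t ht') (hU2 t ht')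
    (Lp.stronglyMeasurable D).measurable (Lp.memLp D) hD0 hind hRt

/-- Let `U t` be the sum of an element `N t` of a Gaussian space and a variable measurable with
respect to an independent σ-algebra. If `N t` is at squared distance at least `b` from the span
of the `N s`, `s ∈ A`, then the conditional variance of `U t` given the `U s` is at least `b`. -/
lemma le_condVar_of_gaussian {Ω : Type*} {m₀ m₁ : MeasurableSpace Ω} [mΩ : MeasurableSpace Ω]
    {P : Measure Ω} [IsProbabilityMeasure P] (hm₀ : m₀ ≤ mΩ)
    (hind : Indep m₀ m₁ P) {V : Submodule ℝ (Lp ℝ 2 P)} (hV : IsGaussianSpace V)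
    (hV1 : IsClosed (V : Set (Lp ℝ 2 P)))
    (hVm : ∀ X ∈ V, AEStronglyMeasurable[m₁] X P) {ι : Type*} {U : ι → Ω → ℝ} {N : ι → Lp ℝ 2 P}
    {t : ι} {A : Set ι} (hU : ∀ s ∈ insert t A, Measurable (U s))
    (hU2 : ∀ s ∈ insert t A, MemLp (U s) 2 P)
    (hN : ∀ s ∈ insert t A, N s ∈ V)
    (hUN : ∀ s ∈ insert t A, AEStronglyMeasurable[m₀] (toL2 P (U s) - N s : Lp ℝ 2 P) P) {b : ℝ}
    (hb : ∀ (I : Finset A) (a : A → ℝ), b ≤ ‖N t - ∑ i ∈ I, a i • N i‖ ^ 2) :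
    ∀ᵐ ω ∂P, b ≤ (Var[U t; P | ⨆ s ∈ A, MeasurableSpace.comap (U s) inferInstance]) ω := by
  set M : Submodule ℝ (Lp ℝ 2 P) :=
    (Submodule.span ℝ (Set.range fun s : A => N s)).topologicalClosure with hM
  have hMV : M ≤ V := by
    refine Submodule.topologicalClosure_minimal _ (Submodule.span_le.2 ?_) hV1
    rintro _ ⟨s, rfl⟩
    exact hN s (Set.mem_insert_of_mem t s.2)
  have htV : N t ∈ V := hN t (Set.mem_insert t A)
  set Q : Lp ℝ 2 P := M.starProjection (N t) with hQ
  have hQM : Q ∈ M := Submodule.starProjection_apply_mem M (N t)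
  set D : Lp ℝ 2 P := N t - Q with hD
  have hDV : D ∈ V := V.sub_mem htV (hMV hQM)
  have hDM : ∀ X ∈ M, inner ℝ D X = 0 := fun X hX => Submodule.starProjection_inner_eq_zero _ _ hX
  -- The bound is a closed condition on the approximant, so it passes from finite combinations to
  -- the projection `Q` in their closure.
  have hDb : b ≤ ‖D‖ ^ 2 := by
    have hcl : IsClosed {X : Lp ℝ 2 P | b ≤ ‖N t - X‖ ^ 2} :=
      isClosed_le continuous_const (by fun_prop)
    refine closure_minimal (s := (Submodule.span ℝ (Set.range fun s : A => N s) :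
      Set (Lp ℝ 2 P))) (fun X hX => ?_) hcl hQM
    obtain ⟨c, rfl⟩ := Finsupp.mem_span_range_iff_exists_finsupp.1 hX
    exact hb c.support c
  have hDm : Measurable (D : Ω → ℝ) := (Lp.stronglyMeasurable D).measurable
  have hXm : ∀ X : Lp ℝ 2 P, Measurable (X : Ω → ℝ) := fun X => (Lp.stronglyMeasurable X).measurable
  have hDM' := (IndepFun_iff_Indep _ _ _).1 (hV.indepFun_of_orthogonal hMV hDV hDM)
  have hVe : ∀ X ∈ V, MeasurableSpace.comap (X : Ω → ℝ) inferInstance ≤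
      eventuallyMeasurableSpace m₁ (ae P) := fun X hX =>
    Measurable.comap_le (Measurable.eventuallyMeasurable_of_eventuallyEq
      (hVm X hX).stronglyMeasurable_mk.measurable (hVm X hX).ae_eq_mk)
  have hMe : MeasurableSpace.comap (fun (ω : Ω) (X : M) => (X : Lp ℝ 2 P) ω) inferInstance ≤
      eventuallyMeasurableSpace m₁ (ae P) := by
    rw [MeasurableSpace.pi, MeasurableSpace.comap_iSup]
    refine iSup_le fun X => ?_
    rw [MeasurableSpace.comap_comp]
    exact hVe X (hMV X.2)
  have hMle : MeasurableSpace.comap (fun (ω : Ω) (X : M) => (X : Lp ℝ 2 P) ω) inferInstance ≤ mΩ :=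
    Measurable.comap_le (measurable_pi_lambda _ fun X => hXm X)
  -- `D` is independent of `σ(M)` by orthogonality, and the two together lie in the completion of
  -- `m₁`, which is independent of `m₀`; hence `D` is independent of `m₀ ⊔ σ(M)`.
  have hind2 : Indep (MeasurableSpace.comap (D : Ω → ℝ) inferInstance)
      (m₀ ⊔ MeasurableSpace.comap (fun (ω : Ω) (X : M) => (X : Lp ℝ 2 P) ω) inferInstance) P :=
    indep_sup_of_indep hm₀ hDm.comap_le hMle hDM'
      (indep_of_indep_of_le_right (Indep.eventuallyMeasurableSpace_right hind)
        (sup_le (hVe D hDV) hMe))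
  have hM𝓔 : ∀ X ∈ M, Measurable[eventuallyMeasurableSpace (m₀ ⊔ MeasurableSpace.comap
      (fun (ω : Ω) (X : M) => (X : Lp ℝ 2 P) ω) inferInstance) (ae P)] (X : Ω → ℝ) :=
    fun X hX => ((measurable_pi_apply (X := fun _ : M => ℝ) ⟨X, hX⟩).comp
      (comap_measurable (fun (ω : Ω) (X : M) => (X : Lp ℝ 2 P) ω))).mono
        (le_sup_right.trans le_eventuallyMeasurableSpace) le_rfl
  refine (le_condVar_of_indep_sub (D := D) (fun f g hf hgf => EventuallyMeasurable.congr hf hgf)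
    hU hU2 (fun s hs => ?_) (fun s hs => hM𝓔 _ (Submodule.le_topologicalClosure _
      (Submodule.subset_span ⟨⟨s, hs⟩, rfl⟩))) ?_ (hV D hDV).2
    (Indep.eventuallyMeasurableSpace_right hind2)).mono fun ω hω => hDb.trans hω
  · exact Measurable.eventuallyMeasurable_of_eventuallyEq
      ((hUN s hs).stronglyMeasurable_mk.measurable.mono le_sup_left le_rfl) (hUN s hs).ae_eq_mk
  · rw [hD, sub_sub_cancel]
    exact hM𝓔 Q hQM

/-! ### The lower bound -/

lemma sum_two_mul_add_one (n : ℕ) : ∑ l ∈ Finset.range n, (2 * (l : ℝ) + 1) = (n : ℝ) ^ 2 := by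
  induction n with
  | zero => simp
  | succ n ih =>
    rw [Finset.sum_range_succ, ih]
    push_cast
    ring

lemma HasPowerDecay.nonneg {C : ℕ → ℝ} {α : ℝ} (hC : HasPowerDecay C α) (l : ℕ) : 0 ≤ C l := by
  obtain ⟨-, c, hc, Υ, h⟩ := hC
  rw [(h l).1]
  have : 0 ≤ Υ l := (inv_nonneg.2 (by linarith)).trans (h l).2.1
  positivity

/-- The frequencies `l` with `l² r ≤ 1` contribute `r ^ (-2 max ((2 - α) / 4) 0)`. -/
lemma HasPowerDecay.exists_le_sum {C : ℕ → ℝ} {α : ℝ} (hC : HasPowerDecay C α) :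
    ∃ K : ℝ, 0 < K ∧ ∀ r : ℝ, 0 < r → r < 1 → ∃ n : ℕ, K * r ^ (-(2 * max ((2 - α) / 4) 0)) ≤
      ∑ l ∈ Finset.range n, C l * ((2 * l + 1) * Real.exp (-(2 * ((l : ℝ) * (l + 1) * r)))) := by
  obtain ⟨hα, c, hc, Υ, h⟩ := hC
  have hc0 : 0 < c⁻¹ := inv_pos.2 (by linarith)
  -- `c⁻¹` is the lower bound on `Υ`; `e^{-4}` bounds the exponential below, since `ℓ(ℓ+1)r ≤ 2` for
  -- every degree kept.
  refine ⟨c⁻¹ * Real.exp (-4), by positivity, fun r hr hr1 => ?_⟩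
  have hCl : ∀ l : ℕ, c⁻¹ * ((l : ℝ) + 1 / 2) ^ (-α) ≤ C l := fun l => by
    rw [(h l).1]
    exact mul_le_mul_of_nonneg_right (h l).2.1 (by positivity)
  -- For `α ≥ 2` no power of `r` is gained and the degree `0` alone suffices, because `(1/2)^{-α} ≥
  -- 1`.
  rcases le_or_gt 2 α with h2 | h2
  · refine ⟨1, ?_⟩
    rw [max_eq_right (by linarith), mul_zero, neg_zero, Real.rpow_zero, mul_one,
      Finset.sum_range_one]
    have h1 : (1 : ℝ) ≤ ((0 : ℕ) + 1 / 2 : ℝ) ^ (-α) :=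
      Real.one_le_rpow_of_pos_of_le_one_of_nonpos (by norm_num) (by norm_num) (by linarith)
    have h3 : c⁻¹ ≤ C 0 := (le_mul_of_one_le_right hc0.le h1).trans (hCl 0)
    have h4 : Real.exp (-4) ≤ 1 := Real.exp_le_one_iff.2 (by norm_num)
    calc c⁻¹ * Real.exp (-4) ≤ C 0 * 1 := by gcongr; exact hc0.le.trans h3
      _ = _ := by simp
  · set y : ℝ := r ^ (-(1 / 2) : ℝ) with hy
    have hy0 : 0 < y := Real.rpow_pos_of_pos hr _
    have hy1 : 1 ≤ y := Real.one_le_rpow_of_pos_of_le_one_of_nonpos hr hr1.le (by norm_num)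
    have hyr : y * y * r = 1 := by
      rw [hy, ← Real.rpow_add hr]
      norm_num
      rw [Real.rpow_neg_one, inv_mul_cancel₀ hr.ne']
    -- With the extra `1`, both `ℓ ≤ y` for every `ℓ < n` (for the exponential) and `y ≤ n` (for the
    -- size of `n^(2-α)`).
    set n : ℕ := ⌊y⌋₊ + 1 with hn
    have hyn : y ≤ n := by
      rw [hn]
      push_cast
      exact (Nat.lt_floor_add_one y).le
    refine ⟨n, ?_⟩
    have hterm : ∀ l ∈ Finset.range n, c⁻¹ * (n : ℝ) ^ (-α) * Real.exp (-4) * (2 * (l : ℝ) + 1) ≤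
        C l * ((2 * l + 1) * Real.exp (-(2 * ((l : ℝ) * (l + 1) * r)))) := by
      intro l hl
      have hln : l < n := Finset.mem_range.1 hl
      have hly : (l : ℝ) ≤ y := (Nat.le_floor_iff hy0.le).1 (by omega)
      have hl1 : (l : ℝ) + 1 ≤ n := by exact_mod_cast hln
      have h1 : (n : ℝ) ^ (-α) ≤ ((l : ℝ) + 1 / 2) ^ (-α) :=
        Real.rpow_le_rpow_of_nonpos (by positivity) (by linarith) (by linarith)
      have h2 : (l : ℝ) * (l + 1) * r ≤ 2 :=
        calc (l : ℝ) * (l + 1) * r ≤ y * (y + y) * r := by gcongr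
          _ = 2 * (y * y * r) := by ring
          _ = 2 := by rw [hyr, mul_one]
      have h3 : Real.exp (-4) ≤ Real.exp (-(2 * ((l : ℝ) * (l + 1) * r))) :=
        Real.exp_le_exp.2 (by linarith)
      calc c⁻¹ * (n : ℝ) ^ (-α) * Real.exp (-4) * (2 * (l : ℝ) + 1)
          = (c⁻¹ * (n : ℝ) ^ (-α)) * ((2 * l + 1) * Real.exp (-4)) := by ring
        _ ≤ C l * ((2 * l + 1) * Real.exp (-(2 * ((l : ℝ) * (l + 1) * r)))) := by
          refine mul_le_mul ((mul_le_mul_of_nonneg_left h1 hc0.le).trans (hCl l)) ?_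
            (by positivity) (le_trans (by positivity) (hCl l))
          exact mul_le_mul_of_nonneg_left h3 (by positivity)
    refine le_trans ?_ (Finset.sum_le_sum hterm)
    rw [← Finset.mul_sum, sum_two_mul_add_one, max_eq_left (by linarith)]
    have hn0 : (0 : ℝ) < n := hy0.trans_le hyn
    have e1 : r ^ (-(2 * ((2 - α) / 4))) = y ^ (2 - α) := by
      rw [hy, ← Real.rpow_mul hr.le]
      congr 1
      ring
    have e2 : (n : ℝ) ^ (-α) * (n : ℝ) ^ 2 = (n : ℝ) ^ (2 - α) := by
      rw [← Real.rpow_natCast, ← Real.rpow_add hn0]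
      congr 1
      push_cast
      ring
    calc c⁻¹ * Real.exp (-4) * r ^ (-(2 * ((2 - α) / 4)))
        ≤ c⁻¹ * Real.exp (-4) * (n : ℝ) ^ (2 - α) := by
          rw [e1]
          gcongr
      _ = c⁻¹ * (n : ℝ) ^ (-α) * Real.exp (-4) * (n : ℝ) ^ 2 := by
          rw [← e2]
          ring

/-- The conditional variance of the mild solution is bounded below by the sum over the modes. -/
lemma IsMildSolution.sum_le_condVar {Ω : Type*} {m₀ : MeasurableSpace Ω} [mΩ : MeasurableSpace Ω]
    {P : Measure Ω} [IsProbabilityMeasure P] {H : ℝ} (hH : 1 / 2 < H) (hH1 : H < 1) {T : ℝ≥0}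
    {C : ℕ → ℝ} (hC : ∀ l, 0 ≤ C l) {β : ℕ → ℤ → ℝ≥0 → Ω → ℂ} (hβ : IsNoiseFamily P H β)
    {u₀ : S2 → Ω → ℝ} {u : ℝ≥0 → S2 → Ω → ℝ} (hu : IsMildSolution P H T C β u₀ u)
    (hm₀ : m₀ ≤ mΩ) (hind : Indep m₀ (noiseSigma β) P)
    (hu₀ : ∀ (l : ℕ) (k : ℤ) (z : ℂ), MemLp (fun ω => (z * initCoeff u₀ l k ω).re) 2 P ∧
        AEStronglyMeasurable[m₀] (fun ω => (z * initCoeff u₀ l k ω).re) P)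
    (x : S2) {t : ℝ≥0} (ht : t ≤ T) {r : ℝ} (hr : 0 < r) (hrt : r ≤ t) (n : ℕ) :
    ∀ᵐ ω ∂P, ∑ l ∈ Finset.range n, C l * ((2 * l + 1) / (4 * Real.pi) * isoConst H *
      (modeConst H * Real.exp (-(2 * ((l : ℝ) * (l + 1) * r))) * r ^ (2 * H))) ≤
        (Var[u t x; P | pastSigma T u x t r]) ω := by
  obtain ⟨hum, J, hJ, hlim⟩ := hu
  have hdec := fun (s : ℝ≥0) (hs : s ≤ T) =>
    IsMildSolution.decomposition hβ hJ hm₀ hind hu₀ hs (hum s hs x) (hlim s hs x)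
  have hT : ∀ s ∈ insert t {s : ℝ≥0 | s ≤ T ∧ r ≤ (t : ℝ) - (s : ℝ)}, s ≤ T := by
    rintro s (rfl | hs)
    exacts [ht, hs.1]
  exact le_condVar_of_gaussian (U := fun s => u s x)
    (N := fun s => (noiseSpace P β).starProjection (toL2 P (u s x))) hm₀ hind
    (isGaussianSpace_noiseSpace hβ) (Submodule.isClosed_topologicalClosure _)
    (fun X hX => aestronglyMeasurable_of_mem_noiseSpace hβ hX) (fun s hs => hum s (hT s hs) x)
    (fun s hs => (hdec s (hT s hs)).1) (fun s _ => Submodule.starProjection_apply_mem _ _)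
    (fun s hs => (hdec s (hT s hs)).2.2)
    fun I a => le_norm_sq_sub_sum hH hH1 hβ hJ x hC (fun s hs => (hdec s hs).2.1) ht hr hrt I a
      (fun i _ => i.2) n

lemma IsMildSolution.sum_le_condVar_of_isAdmissibleInit {Ω : Type*} [mΩ : MeasurableSpace Ω]
    {P : Measure Ω} [IsProbabilityMeasure P] {H : ℝ} (hH : 1 / 2 < H) (hH1 : H < 1) {T : ℝ≥0}
    {C : ℕ → ℝ} (hC : ∀ l, 0 ≤ C l) {β : ℕ → ℤ → ℝ≥0 → Ω → ℂ} (hβ : IsNoiseFamily P H β)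
    {u₀ : S2 → Ω → ℝ} (hu₀ : IsAdmissibleInit P β u₀) {u : ℝ≥0 → S2 → Ω → ℝ}
    (hu : IsMildSolution P H T C β u₀ u) (x : S2) {t : ℝ≥0} (ht : t ≤ T) {r : ℝ} (hr : 0 < r)
    (hrt : r ≤ t) (n : ℕ) :
    ∀ᵐ ω ∂P, ∑ l ∈ Finset.range n, C l * ((2 * l + 1) / (4 * Real.pi) * isoConst H *
      (modeConst H * Real.exp (-(2 * ((l : ℝ) * (l + 1) * r))) * r ^ (2 * H))) ≤
        (Var[u t x; P | pastSigma T u x t r]) ω :=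
  hu₀.exists_sigma.elim fun m hm => IsMildSolution.sum_le_condVar (m₀ := m) (mΩ := mΩ) hH hH1 hC hβ
    hu hm.1 hm.2.1 hm.2.2 x ht hr hrt n

end SphereHeat

end

/-! ### The theorem: collecting the constants. -/

theorem proposition4p3 {Ω : Type*} [MeasurableSpace Ω] (P : Measure Ω) [IsProbabilityMeasure P]
    (H α : ℝ) (hH : 1 / 2 < H) (hH1 : H < 1) (T : ℝ≥0) (hT : 0 < T)
    (C : ℕ → ℝ) (hC : SphereHeat.HasPowerDecay C α)
    (β : ℕ → ℤ → ℝ≥0 → Ω → ℂ) (hβ : SphereHeat.IsNoiseFamily P H β)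
    (u₀ : SphereHeat.S2 → Ω → ℝ) (hu₀ : SphereHeat.IsAdmissibleInit P β u₀)
    (u : ℝ≥0 → SphereHeat.S2 → Ω → ℝ) (hu : SphereHeat.IsMildSolution P H T C β u₀ u)
    (δ : ℝ) (hδ : 0 < δ) :
    ∃ K ε : ℝ, 0 < K ∧ 0 < ε ∧ ε < δ ∧
      ∀ (x : SphereHeat.S2) (t : ℝ≥0) (r : ℝ), 0 < t → t ≤ T → 0 < r → r < ε → r ≤ (t : ℝ) →
        ∀ᵐ ω ∂P, K * r ^ (2 * SphereHeat.timeExponent H α) ≤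
          (Var[u t x; P | SphereHeat.pastSigma T u x t r]) ω := by

  obtain ⟨K, hK, hsum⟩ := hC.exists_le_sum
  have hiso := SphereHeat.isoConst_pos hH hH1
  have hmode := SphereHeat.modeConst_pos hH
  -- `δ/2` makes `ε < δ` strict, and the cap `1` gives `r < 1`, as the frequency sum requires.
  refine ⟨(4 * Real.pi)⁻¹ * SphereHeat.isoConst H * SphereHeat.modeConst H * K, min (δ / 2) 1,
    by positivity, by positivity, (min_le_left _ _).trans_lt (by linarith), ?_⟩
  intro x t r _ htT hr hrε hrt
  obtain ⟨n, hn⟩ := hsum r hr (hrε.trans_le (min_le_right _ _))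
  have hle : (4 * Real.pi)⁻¹ * SphereHeat.isoConst H * SphereHeat.modeConst H * K *
      r ^ (2 * SphereHeat.timeExponent H α) ≤
      ∑ l ∈ Finset.range n, C l * ((2 * l + 1) / (4 * Real.pi) * SphereHeat.isoConst H *
        (SphereHeat.modeConst H * Real.exp (-(2 * ((l : ℝ) * (l + 1) * r))) * r ^ (2 * H))) := by
    have e : r ^ (2 * SphereHeat.timeExponent H α) =
        r ^ (2 * H) * r ^ (-(2 * max ((2 - α) / 4) 0)) := by
      rw [← Real.rpow_add hr, SphereHeat.timeExponent]
      congr 1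
      ring
    calc _ = (4 * Real.pi)⁻¹ * SphereHeat.isoConst H * SphereHeat.modeConst H * r ^ (2 * H) *
          (K * r ^ (-(2 * max ((2 - α) / 4) 0))) := by
          rw [e]
          ring
      _ ≤ _ := mul_le_mul_of_nonneg_left hn (by positivity)
      _ = _ := by
          rw [Finset.mul_sum]
          exact Finset.sum_congr rfl fun l _ => by ring
  exact (hu.sum_le_condVar_of_isAdmissibleInit hH hH1 hC.nonneg hβ hu₀ x htT hr hrt n).mono
    fun ω hω => hle.trans hω
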